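/- Let $(R,\mathfrak m,k)$ be a Cohen–Macaulay (commutative Noetherian) local ring of Krull dimension $d\ge 0$ with a canonical module $\omega$, i.e. a maximal Cohen–Macaulay $R$-module of finite injective dimension and of type one ($\operatorname{Ext}^d_R(k,\omega)\cong k$). A finitely generated $R$-module $M$ is called a $d$-th syzygy if there is an exact sequence $0\to M\to P_1\to P_2\to\cdots\to P_d$ of $R$-modules in which each $P_i$ is a direct summand of a finite direct sum of copies of $R$ (for $d=0$ there is no condition). Then the following conditions are equivalent: 1. $R$ satisfies $(G_{d-1}^R)$: for every prime ideal $\mathfrak p$ of $R$ of height at most $d-1$, the ring $R_{\mathfrak p}$ has finite injective dimension as a module over itself (i.e. $R_{\mathfrak p}$ is Gorenstein); 2. every maximal Cohen–Macaulay $R$-module (nonzero finitely generated $M$ with $\operatorname{depth} M=d$) is a $d$-th syzygy; 3. $\omega$ is a $d$-th syzygy. -/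

import Mathlib

open CategoryTheory

universe u

namespace CMSyzygy

section Local

variable (R : Type u) [CommRing R] [IsLocalRing R]
variable (M : Type u) [AddCommGroup M] [Module R M]

/-- The depth of a (nonzero, finitely generated) module `M` over a local ring `R`: the supremum of
the lengths of the `M`-regular sequences of elements of the maximal ideal. -/
noncomputable def depth : ℕ∞ :=
  ⨆ (rs : List R) (_ : (∀ r ∈ rs, r ∈ IsLocalRing.maximalIdeal R) ∧
    RingTheory.Sequence.IsRegular M rs), (rs.length : ℕ∞)

/-- A maximal Cohen-Macaulay module over a local ring `R`: a nonzero finitely generated module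
whose depth is the Krull dimension of `R`. -/
structure IsMaximalCohenMacaulay : Prop where
  finite : Module.Finite R M
  nontrivial : Nontrivial M
  depth_eq : (depth R M : WithBot ℕ∞) = ringKrullDim R

/-- A Cohen-Macaulay local ring: a Noetherian local ring whose depth is its Krull dimension. -/
structure IsCohenMacaulayLocalRing : Prop where
  isNoetherianRing : IsNoetherianRing R
  depth_eq : (depth R R : WithBot ℕ∞) = ringKrullDim R

/-- `M` has type one: for `n = depth M`, the space `Ext^n(k, M)` is one-dimensional over the
residue field `k`, that is, it is isomorphic to `k`. -/
def HasTypeOne : Prop :=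
  ∃ n : ℕ, depth R M = n ∧
    Nonempty (Abelian.Ext (ModuleCat.of R (IsLocalRing.ResidueField R)) (ModuleCat.of R M) n
      ≃ₗ[R] IsLocalRing.ResidueField R)

end Local

section General

variable (R : Type u) [CommRing R] (M : Type u) [AddCommGroup M] [Module R M]

/-- `M` has finite injective dimension over `R`. -/
def HasFiniteInjectiveDimension : Prop :=
  ∃ n : ℕ, HasInjectiveDimensionLE (ModuleCat.of R M) n

/-- A canonical module of a Cohen-Macaulay local ring `R`: a maximal Cohen-Macaulay module of type
one and of finite injective dimension. -/
structure IsCanonicalModule [IsLocalRing R] : Prop where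
  isMaximalCohenMacaulay : IsMaximalCohenMacaulay R M
  hasTypeOne : HasTypeOne R M
  hasFiniteInjectiveDimension : HasFiniteInjectiveDimension R M

/-- The condition `(G_n^C)`: for every prime ideal `p` of height at most `n`, the
`R_p`-module `C_p` has finite injective dimension. The index `n` is an integer so that `n = -1`
makes sense (there the condition is empty). -/
def SatisfiesG (C : Type u) [AddCommGroup C] [Module R C] (n : ℤ) : Prop :=
  ∀ (p : Ideal R) [p.IsPrime], (∃ h : ℕ, p.height = h ∧ (h : ℤ) ≤ n) →
    HasFiniteInjectiveDimension (Localization.AtPrime p) (LocalizedModule p.primeCompl C)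

/-- `P` is a direct summand of a finite direct sum of copies of `C`. -/
def IsSummandOfFiniteSum (C P : Type u) [AddCommGroup C] [Module R C]
    [AddCommGroup P] [Module R P] : Prop :=
  ∃ (m : ℕ) (i : P →ₗ[R] (Fin m → C)) (s : (Fin m → C) →ₗ[R] P), s ∘ₗ i = LinearMap.id

/-- `M` is an `n`-`C`-syzygy: there is an exact sequence `0 → M → P₁ → P₂ → ⋯ → Pₙ` in which each
`Pᵢ` is a direct summand of a finite direct sum of copies of `C`. Here `X 0` is (a copy of) `M` and
`X i` is `Pᵢ` for `1 ≤ i ≤ n`; the terms and maps beyond `X n` carry no condition. -/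
def IsCSyzygy (C : Type u) [AddCommGroup C] [Module R C] (n : ℕ) : Prop :=
  ∃ (X : ℕ → ModuleCat.{u} R) (f : ∀ i, X i →ₗ[R] X (i + 1)),
    Nonempty (M ≃ₗ[R] X 0) ∧
    (∀ i, 1 ≤ i → i ≤ n → IsSummandOfFiniteSum R C (X i)) ∧
    (1 ≤ n → Function.Injective (f 0)) ∧
    (∀ i, i + 2 ≤ n → Function.Exact (f i) (f (i + 1)))

/-- `M` is an `n`-th syzygy: the case `C = R`, so that the `Pᵢ` are the finitely generated
projective `R`-modules. -/
def IsSyzygy (n : ℕ) : Prop := IsCSyzygy R M R n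

end General

end CMSyzygy

/-! By `height_le_sub_one_iff`, condition 1 says that `R` is Gorenstein on the punctured spectrum.
Condition 3 is a special case of 2.

From 1 to 2: let `f : M → R^n` have as coordinates generators of the dual of `M`, so that every map
`M → R` factors through `f`. If `M` has positive depth and `Ext^{>0}(M_p, R_p) = 0` for all `p ≠ m`,
then `f` is injective: an associated prime `p` of the kernel cannot be `m`, and for `p ≠ m` a socle
element of `M_p` is detected by some map to `R_p`, which factors through `f_p`. The cokernel is
again locally `Ext`-acyclic, its `Ext¹` vanishing because maps to `R_p` extend along `f_p`, and the
guaranteed depth drops by one. Repeating this `d` times gives `LocallyExtVanishes.isSyzygy`. Modules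
of depth `d` satisfy its hypotheses by `extVanishes_localization`.

From 3 to 1: let `0 → ω → P → C → 0` with `P` projective and `C` a `(d-1)`-st syzygy. Dimension
shifting embeds `Ext¹(C, ω)` in a top `Ext^d(-, ω)`, which is `s`-power torsion for each `s ∈ m`
(`FgInjDimLE.exists_pow_smul_eq_zero`). Hence some `s^t • id` extends from `ω` to `P`. At a prime
avoiding `s` this splits the inclusion, so `ω_p` is free. It is nonzero because `ω` is faithful
(`FgInjDimLE.annihilator_eq_bot`), so `R_p` is a summand of `ω_p` and inherits finite injective
dimension. -/

namespace CMSyzygy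

open Abelian IsLocalRing

/-! ### Long exact sequences and functoriality for `Ext` -/

section ExtVanishing

variable {R : Type u} [CommRing R]

/-- The vanishing of `Ext^i(N, T)`. -/
def ExtVanishes (R : Type u) [CommRing R] (N T : Type u) [AddCommGroup N] [Module R N]
    [AddCommGroup T] [Module R T] (i : ℕ) : Prop :=
  Subsingleton (Ext (ModuleCat.of R N) (ModuleCat.of R T) i)

variable {A B C N T X : Type u} [AddCommGroup A] [Module R A] [AddCommGroup B] [Module R B]
  [AddCommGroup C] [Module R C] [AddCommGroup N] [Module R N] [AddCommGroup T] [Module R T]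
  [AddCommGroup X] [Module R X]

/-- The short complex of modules given by an exact pair of linear maps. -/
abbrev shortComplexOfExact (f : A →ₗ[R] B) (g : B →ₗ[R] C) (h : Function.Exact f g) :
    ShortComplex (ModuleCat.{u} R) :=
  ModuleCat.shortComplexOfCompEqZero f g h.linearMap_comp_eq_zero

lemma shortExact_shortComplexOfExact {f : A →ₗ[R] B} {g : B →ₗ[R] C} (h : Function.Exact f g)
    (hf : Function.Injective f) (hg : Function.Surjective g) :
    (shortComplexOfExact f g h).ShortExact :=
  ModuleCat.shortComplex_shortExact _ h hf hg

section LongExactSequence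

variable {f : A →ₗ[R] B} {g : B →ₗ[R] C} (h : Function.Exact f g)
    (hf : Function.Injective f) (hg : Function.Surjective g)

include h hf hg

lemma ExtVanishes.of_exact_middle {i : ℕ} (hA : ExtVanishes R A T i) (hC : ExtVanishes R C T i) :
    ExtVanishes R B T i := by
  refine subsingleton_of_forall_eq 0 fun x ↦ ?_
  obtain ⟨y, rfl⟩ := Ext.contravariant_sequence_exact₂ (shortExact_shortComplexOfExact h hf hg)
    (ModuleCat.of R T) x (hA.elim _ _)
  rw [hC.elim y 0, Ext.comp_zero]

lemma ExtVanishes.of_exact_left {i : ℕ} (hB : ExtVanishes R B T i)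
    (hC : ExtVanishes R C T (i + 1)) : ExtVanishes R A T i := by
  refine subsingleton_of_forall_eq 0 fun x ↦ ?_
  obtain ⟨y, rfl⟩ := Ext.contravariant_sequence_exact₁ (shortExact_shortComplexOfExact h hf hg)
    (ModuleCat.of R T) x (add_comm 1 i) (hC.elim _ _)
  rw [hB.elim y 0, Ext.comp_zero]

lemma ExtVanishes.of_exact_right {i : ℕ} (hA : ExtVanishes R A T i)
    (hB : ExtVanishes R B T (i + 1)) : ExtVanishes R C T (i + 1) := by
  refine subsingleton_of_forall_eq 0 fun x ↦ ?_
  obtain ⟨y, rfl⟩ := Ext.contravariant_sequence_exact₃ (shortExact_shortComplexOfExact h hf hg)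
    (ModuleCat.of R T) x (hB.elim _ _) (add_comm 1 i)
  rw [hA.elim y 0, Ext.comp_zero]

/-- If every map `A → T` extends along `f : A → B` then `Ext¹(C, T)` embeds in `Ext¹(B, T)`. -/
lemma ExtVanishes.one_of_forall_extend (hB : ExtVanishes R B T 1)
    (hext : ∀ φ : A →ₗ[R] T, ∃ ψ : B →ₗ[R] T, ψ ∘ₗ f = φ) : ExtVanishes R C T 1 := by
  refine subsingleton_of_forall_eq 0 fun x ↦ ?_
  have hS := shortExact_shortComplexOfExact h hf hg
  obtain ⟨y, rfl⟩ := Ext.contravariant_sequence_exact₃ hS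
    (ModuleCat.of R T) x (hB.elim _ _) (add_comm 1 0)
  obtain ⟨φ, rfl⟩ := Ext.homEquiv₀.symm.surjective y
  obtain ⟨ψ, hψ⟩ := hext φ.hom
  have hφ : φ = (shortComplexOfExact f g h).f ≫ ModuleCat.ofHom ψ := by
    ext1
    exact hψ.symm
  rw [Ext.homEquiv₀_symm_apply, hφ, ← Ext.mk₀_comp_mk₀]
  exact hS.extClass_comp_assoc _

lemma exists_extend_of_extVanishes (hC : ExtVanishes R C T 1) (φ : A →ₗ[R] T) :
    ∃ ψ : B →ₗ[R] T, ψ ∘ₗ f = φ := by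
  obtain ⟨y, hy⟩ := Ext.contravariant_sequence_exact₁ (shortExact_shortComplexOfExact h hf hg)
    (ModuleCat.of R T) (Ext.mk₀ (ModuleCat.ofHom φ)) (add_comm 1 0) (hC.elim _ _)
  obtain ⟨ψ, rfl⟩ := Ext.homEquiv₀.symm.surjective y
  rw [Ext.homEquiv₀_symm_apply, Ext.mk₀_comp_mk₀] at hy
  have := (Ext.mk₀_bijective _ _).1 hy
  exact ⟨ψ.hom, congrArg ModuleCat.Hom.hom this⟩

/-- The obstruction to extending `φ` is its image under the connecting map in `Ext¹(C, T)`, and `r`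
kills it. -/
lemma exists_extend_smul {r : R}
    (hC : ∀ y : Ext (ModuleCat.of R C) (ModuleCat.of R T) 1, r • y = 0) (φ : A →ₗ[R] T) :
    ∃ ψ : B →ₗ[R] T, ψ ∘ₗ f = r • φ := by
  obtain ⟨y, hy⟩ := Ext.contravariant_sequence_exact₁ (shortExact_shortComplexOfExact h hf hg)
    (ModuleCat.of R T) (r • Ext.mk₀ (ModuleCat.ofHom φ)) (add_comm 1 0)
    (by rw [Ext.comp_smul]; exact hC _)
  obtain ⟨ψ, rfl⟩ := Ext.homEquiv₀.symm.surjective y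
  rw [Ext.homEquiv₀_symm_apply, Ext.mk₀_comp_mk₀, ← Ext.mk₀_smul] at hy
  have := (Ext.mk₀_bijective _ _).1 hy
  exact ⟨ψ.hom, congrArg ModuleCat.Hom.hom this⟩

lemma smul_ext_eq_zero_of_exact {r : R} {i : ℕ} (hB : ExtVanishes R B T i)
    (hC : ∀ y : Ext (ModuleCat.of R C) (ModuleCat.of R T) (i + 1), r • y = 0)
    (x : Ext (ModuleCat.of R A) (ModuleCat.of R T) i) : r • x = 0 := by
  obtain ⟨y, hy⟩ := Ext.contravariant_sequence_exact₁ (shortExact_shortComplexOfExact h hf hg)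
    (ModuleCat.of R T) (r • x) (add_comm 1 i) (by rw [Ext.comp_smul]; exact hC _)
  rw [← hy, hB.elim y 0, Ext.comp_zero]

lemma ExtVanishes.of_exact_covariant_right {i : ℕ} (hB : ExtVanishes R X B i)
    (hA : ExtVanishes R X A (i + 1)) : ExtVanishes R X C i := by
  refine subsingleton_of_forall_eq 0 fun x ↦ ?_
  obtain ⟨y, rfl⟩ := Ext.covariant_sequence_exact₃ (ModuleCat.of R X)
    (shortExact_shortComplexOfExact h hf hg) x rfl (hA.elim _ _)
  rw [hB.elim y 0, Ext.zero_comp]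

end LongExactSequence

lemma extVanishes_zero_iff : ExtVanishes R N T 0 ↔ ∀ φ : N →ₗ[R] T, φ = 0 := by
  have e : Ext (ModuleCat.of R N) (ModuleCat.of R T) 0 ≃ (N →ₗ[R] T) :=
    (Ext.linearEquiv₀ (R := R).trans ModuleCat.homLinearEquiv).toEquiv
  rw [ExtVanishes, e.subsingleton_congr]
  exact ⟨fun _ φ ↦ Subsingleton.elim _ _, fun h ↦ ⟨fun a b ↦ (h a).trans (h b).symm⟩⟩

lemma ExtVanishes.congr {N' T' : Type u} [AddCommGroup N'] [Module R N'] [AddCommGroup T']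
    [Module R T'] (e : N ≃ₗ[R] N') (e' : T ≃ₗ[R] T') {i : ℕ} (h : ExtVanishes R N T i) :
    ExtVanishes R N' T' i := by
  refine subsingleton_of_forall_eq 0 fun x ↦ ?_
  have h1 : x = (Ext.mk₀ e.symm.toModuleIso.hom).comp
      (((Ext.mk₀ e.toModuleIso.hom).comp (x.comp (Ext.mk₀ e'.symm.toModuleIso.hom) (add_zero i))
        (zero_add i)).comp (Ext.mk₀ e'.toModuleIso.hom) (add_zero i)) (zero_add i) := by
    have h2 : e.symm.toModuleIso.hom ≫ e.toModuleIso.hom = 𝟙 _ := by ext; simp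
    have h3 : e'.symm.toModuleIso.hom ≫ e'.toModuleIso.hom = 𝟙 _ := by ext; simp
    rw [Ext.comp_assoc_of_third_deg_zero, Ext.comp_assoc_of_third_deg_zero, Ext.mk₀_comp_mk₀,
      h3, Ext.comp_mk₀_id, Ext.mk₀_comp_mk₀_assoc, h2, Ext.mk₀_id_comp]
  rw [h1, h.elim (Ext.comp _ _ _) 0, Ext.zero_comp, Ext.comp_zero]

lemma ExtVanishes.of_subsingleton_left [Subsingleton N] {i : ℕ} : ExtVanishes R N T i := by
  refine subsingleton_of_forall_eq 0 fun x ↦ ?_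
  have : (𝟙 (ModuleCat.of R N)) = 0 := by
    ext x
    exact Subsingleton.elim (α := N) _ _
  rw [← Ext.mk₀_id_comp x, this, Ext.mk₀_zero, Ext.zero_comp]

lemma ExtVanishes.of_projective [Module.Projective R N] {i : ℕ} :
    ExtVanishes R N T (i + 1) := by
  have : Projective (ModuleCat.of R N) := (IsProjective.iff_projective N).mp inferInstance
  exact Ext.subsingleton_of_projective _ _ _

/-- The map on `Ext` induced by a linear map in the first variable. -/
noncomputable def extMap (f : A →ₗ[R] B) (T : Type u) [AddCommGroup T] [Module R T] (i : ℕ) :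
    Ext (ModuleCat.of R B) (ModuleCat.of R T) i →ₗ[R]
      Ext (ModuleCat.of R A) (ModuleCat.of R T) i :=
  (Ext.mk₀ (ModuleCat.ofHom f)).precompOfLinear R _ (zero_add i)

lemma extMap_apply (f : A →ₗ[R] B) (i : ℕ) (x : Ext (ModuleCat.of R B) (ModuleCat.of R T) i) :
    extMap f T i x = (Ext.mk₀ (ModuleCat.ofHom f)).comp x (zero_add i) := rfl

lemma extMap_comp (f : A →ₗ[R] B) (g : B →ₗ[R] C) (i : ℕ)
    (x : Ext (ModuleCat.of R C) (ModuleCat.of R T) i) :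
    extMap (g ∘ₗ f) T i x = extMap f T i (extMap g T i x) := by
  simp only [extMap_apply, Ext.mk₀_comp_mk₀_assoc]
  rfl

lemma extMap_smul_id (r : R) (i : ℕ) (x : Ext (ModuleCat.of R A) (ModuleCat.of R T) i) :
    extMap (r • (LinearMap.id : A →ₗ[R] A)) T i x = r • x := by
  have : ModuleCat.ofHom (r • (LinearMap.id : A →ₗ[R] A)) = r • 𝟙 (ModuleCat.of R A) := rfl
  rw [extMap_apply, this, Ext.mk₀_smul, Ext.smul_comp, Ext.mk₀_id_comp]

lemma extMap_injective {f : A →ₗ[R] B} {g : B →ₗ[R] C} (h : Function.Exact f g)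
    (hf : Function.Injective f) (hg : Function.Surjective g) {i : ℕ}
    (hA : ExtVanishes R A T i) : Function.Injective (extMap g T (i + 1)) := by
  rw [injective_iff_map_eq_zero]
  intro x hx
  obtain ⟨y, rfl⟩ := Ext.contravariant_sequence_exact₃ (shortExact_shortComplexOfExact h hf hg)
    (ModuleCat.of R T) x hx (add_comm 1 i)
  rw [hA.elim y 0, Ext.comp_zero]

lemma extMap_injective_left {f : A →ₗ[R] B} {g : B →ₗ[R] C} (h : Function.Exact f g)
    (hf : Function.Injective f) (hg : Function.Surjective g) {i : ℕ}
    (hC : ExtVanishes R C T i) : Function.Injective (extMap f T i) := by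
  rw [injective_iff_map_eq_zero]
  intro x hx
  obtain ⟨y, rfl⟩ := Ext.contravariant_sequence_exact₂ (shortExact_shortComplexOfExact h hf hg)
    (ModuleCat.of R T) x hx
  rw [hC.elim y 0, Ext.comp_zero]

lemma extMap_surjective {f : A →ₗ[R] B} {g : B →ₗ[R] C} (h : Function.Exact f g)
    (hf : Function.Injective f) (hg : Function.Surjective g) {i : ℕ}
    (hC : ExtVanishes R C T (i + 1)) : Function.Surjective (extMap f T i) := fun x ↦
  Ext.contravariant_sequence_exact₁ (shortExact_shortComplexOfExact h hf hg)
    (ModuleCat.of R T) x (add_comm 1 i) (hC.elim _ _)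

lemma smul_ext_eq_zero_of_forall_smul_eq_zero {r : R} (hr : ∀ t : T, r • t = 0) {i : ℕ}
    (x : Ext (ModuleCat.of R N) (ModuleCat.of R T) i) : r • x = 0 := by
  have : r • 𝟙 (ModuleCat.of R T) = 0 := by
    ext t
    exact hr t
  rw [Ext.smul_eq_comp_mk₀, this, Ext.mk₀_zero, Ext.comp_zero]

lemma smul_ext_eq_zero_of_forall_smul_eq_zero_left {r : R} (hr : ∀ n : N, r • n = 0) {i : ℕ}
    (x : Ext (ModuleCat.of R N) (ModuleCat.of R T) i) : r • x = 0 := by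
  have : r • 𝟙 (ModuleCat.of R N) = 0 := by
    ext t
    exact hr t
  rw [← Ext.mk₀_id_comp x, ← Ext.smul_comp, ← Ext.mk₀_smul, this, Ext.mk₀_zero, Ext.zero_comp]

end ExtVanishing

/-! ### Nakayama's lemma for `Ext` -/

section Local

open Pointwise

variable {R : Type u} [CommRing R] [IsLocalRing R] [IsNoetherianRing R]
  {N T : Type u} [AddCommGroup N] [Module R N] [Module.Finite R N]
  [AddCommGroup T] [Module R T] [Module.Finite R T]

/-- The long exact sequence of multiplication by `x` makes `x` act surjectively on the finitely
generated module `Ext^i(N, T)`, which Nakayama then kills. -/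
lemma ExtVanishes.of_isSMulRegular {x : R} (hx : x ∈ maximalIdeal R)
    (hreg : IsSMulRegular N x) {i : ℕ} (h : ExtVanishes R (QuotSMulTop x N) T (i + 1)) :
    ExtVanishes R N T i := by
  have hsurj : Function.Surjective (extMap (LinearMap.lsmul R N x) T i) :=
    extMap_surjective (LinearMap.exact_lsmul_mkQ_smul_top N x) hreg
      (Submodule.mkQ_surjective _) h
  have hfin : Module.Finite R (Ext (ModuleCat.of R N) (ModuleCat.of R T) i) :=
    ModuleCat.finite_ext R _ _ i
  have htop : (⊤ : Submodule R (Ext (ModuleCat.of R N) (ModuleCat.of R T) i)) ≤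
      maximalIdeal R • ⊤ := by
    intro y _
    obtain ⟨z, rfl⟩ := hsurj y
    have : LinearMap.lsmul R N x = x • LinearMap.id := rfl
    rw [this, extMap_smul_id]
    exact Submodule.smul_mem_smul hx trivial
  have := Submodule.eq_bot_of_le_smul_of_le_jacobson_bot _ _ hfin.fg_top htop
    (IsLocalRing.maximalIdeal_le_jacobson _)
  exact (Submodule.subsingleton_iff R).mp (subsingleton_of_bot_eq_top this.symm)

end Local

/-! ### Injective dimension tested on finitely generated modules -/

section InjectiveDimension

open Pointwise RingTheory.Sequence

/-- `Ext^i(L, T)` vanishes for all finitely generated `L` and all `i > n`. -/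
def FgInjDimLE (R : Type u) [CommRing R] (T : Type u) [AddCommGroup T] [Module R T] (n : ℕ) :
    Prop :=
  ∀ (L : Type u) [AddCommGroup L] [Module R L] [Module.Finite R L] (i : ℕ), n < i →
    ExtVanishes R L T i

lemma HasFiniteInjectiveDimension.exists_fgInjDimLE {R : Type u} [CommRing R] {T : Type u}
    [AddCommGroup T] [Module R T] (h : HasFiniteInjectiveDimension R T) :
    ∃ n, FgInjDimLE R T n := by
  obtain ⟨n, hn⟩ := h
  exact ⟨n, fun L _ _ _ i hi ↦ HasInjectiveDimensionLT.subsingleton _ (n + 1) i hi _⟩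

variable {R : Type u} [CommRing R]

section Sequence

variable {T : Type u} [AddCommGroup T] [Module R T]

/-- Each regular element raises the degree beyond which `Ext` vanishes by at most one. -/
lemma ExtVanishes.quotient_of_isWeaklyRegular (rs : List R) {M : Type u} [AddCommGroup M]
    [Module R M] (hreg : IsWeaklyRegular M rs) {c : ℕ} (h : ∀ i, c < i → ExtVanishes R M T i) :
    ∀ i, c + rs.length < i →
      ExtVanishes R (M ⧸ (Ideal.ofList rs • ⊤ : Submodule R M)) T i := by
  induction rs generalizing M c with
  | nil =>
    intro i hi
    have e : M ≃ₗ[R] M ⧸ (Ideal.ofList ([] : List R) • ⊤ : Submodule R M) :=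
      (Submodule.quotEquivOfEqBot _ (by simp)).symm
    exact (h i (by simpa using hi)).congr e (LinearEquiv.refl R T)
  | cons r rs ih =>
    intro i hi
    rw [isWeaklyRegular_cons_iff] at hreg
    have h1 : ∀ i, c + 1 < i → ExtVanishes R (QuotSMulTop r M) T i := by
      rintro (_ | i) hi
      · omega
      · exact .of_exact_right (LinearMap.exact_lsmul_mkQ_smul_top M r) hreg.1
          (Submodule.mkQ_surjective _) (h i (by omega)) (h (i + 1) (by omega))
    exact (ih hreg.2 h1 i (by simp only [List.length_cons] at hi; omega)).congr
      (Submodule.quotOfListConsSMulTopEquivQuotSMulTopInner M r rs).symm (LinearEquiv.refl R T)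

variable [IsLocalRing R] [IsNoetherianRing R] [Module.Finite R T]

/-- Each element of the sequence gains one degree over the general bound, by Nakayama. -/
lemma FgInjDimLE.extVanishes_of_isWeaklyRegular (rs : List R) {N : Type u} [AddCommGroup N]
    [Module R N] [Module.Finite R N] (hmem : ∀ r ∈ rs, r ∈ maximalIdeal R)
    (hreg : IsWeaklyRegular N rs) {c : ℕ} (h : FgInjDimLE R T (c + rs.length)) :
    ∀ i, c < i → ExtVanishes R N T i := by
  induction rs generalizing N c with
  | nil => exact fun i hi ↦ h N i (by simpa using hi)
  | cons r rs ih =>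
    intro i hi
    rw [isWeaklyRegular_cons_iff] at hreg
    refine .of_isSMulRegular (hmem r (by simp)) hreg.1
      (ih (c := c + 1) (fun s hs ↦ hmem s (by simp [hs])) hreg.2 ?_ (i + 1) (by omega))
    simpa [add_assoc, add_comm, add_left_comm] using h

end Sequence

variable [IsLocalRing R] [IsNoetherianRing R] {T : Type u} [AddCommGroup T] [Module R T]
  [Module.Finite R T]

/-- If `Ext^i(k, T) = 0` and `Ext^{i+1}` vanishes on finitely generated modules, then so does
`Ext^i`. -/
lemma extVanishes_of_residueField {i : ℕ} (hk : ExtVanishes R (ResidueField R) T i)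
    (h : ∀ (L : Type u) [AddCommGroup L] [Module R L] [Module.Finite R L],
      ExtVanishes R L T (i + 1))
    (N : Type u) [AddCommGroup N] [Module R N] [hN : Module.Finite R N] : ExtVanishes R N T i := by
  induction hN using IsNoetherianRing.induction_on_isQuotientEquivQuotientPrime R with
  | subsingleton N => exact .of_subsingleton_left
  | quotient N p e =>
    -- In a prime filtration the factors are `k`, covered by `hk`, and `R/p` with `p ≠ m`, on which
    -- any `x ∈ m \ p` is regular.
    by_cases hp : p.1 = maximalIdeal R
    · exact hk.congr ((Submodule.quotEquivOfEq _ _ hp.symm : (R ⧸ maximalIdeal R) ≃ₗ[R] _).trans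
        e.symm) (LinearEquiv.refl R T)
    · obtain ⟨x, hx, hxp⟩ := SetLike.not_le_iff_exists.mp
        fun hle ↦ hp (le_antisymm (le_maximalIdeal p.2.ne_top) hle)
      refine .of_isSMulRegular hx ?_ (h _)
      rw [e.isSMulRegular_congr, isSMulRegular_quotient_iff_mem_of_smul_mem]
      exact fun y hy ↦ (p.2.mem_or_mem hy).resolve_left hxp
  | exact N₁ N₂ N₃ f g hf hg hfg h₁ h₃ => exact .of_exact_middle hfg hf hg h₁ h₃

lemma FgInjDimLE.of_extVanishes_residueField {n : ℕ} (h : FgInjDimLE R T (n + 1))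
    (hk : ExtVanishes R (ResidueField R) T (n + 1)) : FgInjDimLE R T n := by
  intro L _ _ _ i hi
  obtain rfl | hi' := Nat.eq_or_lt_of_le (show n + 1 ≤ i from hi)
  · exact extVanishes_of_residueField hk (fun L _ _ _ ↦ h L _ (by omega)) L
  · exact h L i hi'

/-- Bass: the injective dimension of a finitely generated module is bounded by the length of a
regular sequence of the ring whose quotient has depth zero. -/
lemma FgInjDimLE.le_length_of_isWeaklyRegular {n : ℕ} (h : FgInjDimLE R T n) {rs : List R}
    (hreg : IsWeaklyRegular R rs)
    (ι : ResidueField R →ₗ[R] R ⧸ (Ideal.ofList rs • ⊤ : Submodule R R))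
    (hι : Function.Injective ι) : FgInjDimLE R T rs.length := by
  induction n with
  | zero => exact fun L _ _ _ i hi ↦ h L i (by omega)
  | succ n ih =>
    by_cases hn : n + 1 ≤ rs.length
    · exact fun L _ _ _ i hi ↦ h L i (by omega)
    refine ih (h.of_extVanishes_residueField ?_)
    have h0 : ∀ i, 0 < i → ExtVanishes R R T i := by
      rintro (_ | i) hi
      · omega
      · exact .of_projective
    -- `Ext^{n+1}(k, T)` lies between `Ext^{n+1}(R/(rs), T)`, zero since `n + 1 > rs.length`, and
    -- `Ext^{n+2}` of the cokernel of `ι`.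
    exact .of_exact_left ι.exact_map_mkQ_range hι (Submodule.mkQ_surjective _)
      (ExtVanishes.quotient_of_isWeaklyRegular rs hreg h0 _ (by omega)) (h _ _ (by omega))

/-- As long as `Ext^n(k, T)` vanishes the bound can be lowered. The descent stops by degree zero,
where vanishing would force the identity of `T` to be zero. -/
lemma FgInjDimLE.exists_not_extVanishes [Nontrivial T] {n : ℕ} (h : FgInjDimLE R T n) :
    ∃ m, FgInjDimLE R T m ∧ ¬ ExtVanishes R (ResidueField R) T m := by
  induction n with
  | zero =>
    refine ⟨0, h, fun hk ↦ ?_⟩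
    have h1 := extVanishes_of_residueField hk (fun L _ _ _ ↦ h L _ (by omega)) T
    obtain ⟨t, ht⟩ := exists_ne (0 : T)
    exact ht (congr($(extVanishes_zero_iff.mp h1 LinearMap.id) t))
  | succ n ih =>
    by_cases hk : ExtVanishes R (ResidueField R) T (n + 1)
    · exact ih (h.of_extVanishes_residueField hk)
    · exact ⟨n + 1, h, hk⟩

omit [IsNoetherianRing R] in
/-- The embedding of the residue field given by an element annihilated by the maximal ideal. -/
lemma exists_residueField_injective {N : Type u} [AddCommGroup N] [Module R N] {y : N}
    (hy : y ≠ 0) (hm : ∀ a ∈ maximalIdeal R, a • y = 0) :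
    ∃ ι : ResidueField R →ₗ[R] N, Function.Injective ι ∧ ∀ a : R, ι (residue R a) = a • y := by
  let ι : (R ⧸ maximalIdeal R) →ₗ[R] N :=
    (maximalIdeal R).liftQ (LinearMap.toSpanSingleton R N y) (fun a ha ↦ by simpa using hm a ha)
  have hι : Function.Injective ι := by
    rw [← LinearMap.ker_eq_bot]
    refine Submodule.ker_liftQ_eq_bot _ _ _ fun a ha ↦ ?_
    rw [mem_maximalIdeal, mem_nonunits_iff]
    intro hu
    exact hy ((hu.smul_eq_zero).mp (by simpa using ha))
  exact ⟨ι, hι, fun a ↦ (Submodule.liftQ_apply _ _ _).trans (by simp)⟩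

/-- Over a ring of finite injective dimension, a socle element of a module `N` with
`Ext^{>0}(N, T) = 0` is detected by a map to `T`. -/
lemma FgInjDimLE.exists_apply_ne_zero [Nontrivial T] {n : ℕ} (h : FgInjDimLE R T n)
    {N : Type u} [AddCommGroup N] [Module R N] [Module.Finite R N]
    (hN : ∀ i, 0 < i → ExtVanishes R N T i) {y : N} (hy : y ≠ 0)
    (hm : ∀ a ∈ maximalIdeal R, a • y = 0) : ∃ φ : N →ₗ[R] T, φ y ≠ 0 := by
  obtain ⟨ι, hι, hιy⟩ := exists_residueField_injective hy hm
  obtain ⟨m, hm, hk⟩ := h.exists_not_extVanishes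
  have hC := hm (N ⧸ LinearMap.range ι) (m + 1) (by omega)
  cases m with
  | succ m =>
    exact absurd (.of_exact_left ι.exact_map_mkQ_range hι (Submodule.mkQ_surjective _)
      (hN _ (by omega)) hC) hk
  | zero =>
    -- Only `m = 0` survives. Then every map `k → T` extends to `N`, so if all maps `N → T` killed
    -- `y`, `Hom(k, T)` would vanish.
    by_contra! hcon
    refine hk (extVanishes_zero_iff.mpr fun φ ↦ ?_)
    obtain ⟨ψ, rfl⟩ := exists_extend_of_extVanishes ι.exact_map_mkQ_range hι
      (Submodule.mkQ_surjective _) hC φ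
    ext a
    obtain ⟨a, rfl⟩ := residue_surjective a
    simp [hιy, hcon]

end InjectiveDimension

/-! ### Depth through `Ext` from the residue field -/

section Depth

open Pointwise RingTheory.Sequence

/-- `Ext^i(k, M) = 0` for all `i < t`: the module `M` has depth at least `t`. -/
def DepthGE (R : Type u) [CommRing R] [IsLocalRing R] (M : Type u) [AddCommGroup M] [Module R M]
    (t : ℕ) : Prop :=
  ∀ i, i < t → ExtVanishes R (ResidueField R) M i

variable {R : Type u} [CommRing R] [IsLocalRing R]

section Basic

variable {M : Type u} [AddCommGroup M] [Module R M]

lemma DepthGE.mono {s t : ℕ} (h : DepthGE R M t) (hst : s ≤ t) : DepthGE R M s :=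
  fun i hi ↦ h i (by omega)

lemma DepthGE.congr {M' : Type u} [AddCommGroup M'] [Module R M'] (e : M ≃ₗ[R] M') {t : ℕ}
    (h : DepthGE R M t) : DepthGE R M' t :=
  fun i hi ↦ (h i hi).congr (LinearEquiv.refl R _) e

lemma DepthGE.eq_zero_of_smul_eq_zero {t : ℕ} (h : DepthGE R M (t + 1)) {y : M}
    (hm : ∀ a ∈ maximalIdeal R, a • y = 0) : y = 0 := by
  by_contra hy
  obtain ⟨ι, -, hιy⟩ := exists_residueField_injective hy hm
  have := hιy 1
  rw [extVanishes_zero_iff.mp (h 0 (by omega)) ι] at this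
  exact hy (by simpa using this.symm)

lemma DepthGE.of_exact_right {A B C : Type u} [AddCommGroup A] [Module R A] [AddCommGroup B]
    [Module R B] [AddCommGroup C] [Module R C] {f : A →ₗ[R] B} {g : B →ₗ[R] C}
    (h : Function.Exact f g) (hf : Function.Injective f) (hg : Function.Surjective g) {t : ℕ}
    (hA : DepthGE R A (t + 1)) (hB : DepthGE R B t) : DepthGE R C t :=
  fun i hi ↦ .of_exact_covariant_right h hf hg (hB i hi) (hA (i + 1) (by omega))

lemma DepthGE.quotSMulTop {t : ℕ} (h : DepthGE R M (t + 1)) {x : R} (hx : IsSMulRegular M x) :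
    DepthGE R (QuotSMulTop x M) t :=
  .of_exact_right (LinearMap.exact_lsmul_mkQ_smul_top M x) hx (Submodule.mkQ_surjective _) h
    (h.mono (by omega))

lemma DepthGE.quotient_of_isWeaklyRegular (rs : List R) {M : Type u} [AddCommGroup M]
    [Module R M] (hreg : IsWeaklyRegular M rs) {t : ℕ} (h : DepthGE R M (t + rs.length)) :
    DepthGE R (M ⧸ (Ideal.ofList rs • ⊤ : Submodule R M)) t := by
  induction rs generalizing M with
  | nil => exact DepthGE.congr (Submodule.quotEquivOfEqBot _ (by simp)).symm h
  | cons r rs ih =>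
    rw [isWeaklyRegular_cons_iff] at hreg
    exact (ih hreg.2 (DepthGE.quotSMulTop h hreg.1)).congr
      (Submodule.quotOfListConsSMulTopEquivQuotSMulTopInner M r rs).symm

/-- A direct product of copies of a module has at least the same depth. -/
lemma DepthGE.pi {t n : ℕ} (h : DepthGE R M t) : DepthGE R (Fin n → M) t := by
  induction n with
  | zero =>
    intro i hi
    refine subsingleton_of_forall_eq 0 fun x ↦ ?_
    have : 𝟙 (ModuleCat.of R (Fin 0 → M)) = 0 := by
      exact ModuleCat.hom_ext (LinearMap.ext fun x ↦ Subsingleton.elim (α := Fin 0 → M) _ _)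
    rw [← Ext.comp_mk₀_id x, this, Ext.mk₀_zero, Ext.comp_zero]
  | succ n ih =>
    intro i hi
    have e := (Fin.consLinearEquiv R (fun _ : Fin (n + 1) ↦ M))
    refine ExtVanishes.congr (LinearEquiv.refl R _) e ?_
    refine subsingleton_of_forall_eq 0 fun x ↦ ?_
    have hex : Function.Exact (LinearMap.inl R M (Fin n → M)) (LinearMap.snd R M (Fin n → M)) :=
      .inl_snd
    obtain ⟨y, rfl⟩ := Ext.covariant_sequence_exact₂ (ModuleCat.of R (ResidueField R))
      (shortExact_shortComplexOfExact hex LinearMap.inl_injective LinearMap.snd_surjective) x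
      ((ih i hi).elim _ _)
    rw [(h i hi).elim y 0, Ext.zero_comp]

end Basic

variable [IsNoetherianRing R]

section Finite

variable {M : Type u} [AddCommGroup M] [Module R M] [Module.Finite R M]

omit [IsNoetherianRing R] in
lemma maximalIdeal_smul_top_lt [Nontrivial M] : maximalIdeal R • (⊤ : Submodule R M) < ⊤ := by
  refine lt_top_iff_ne_top.mpr fun h ↦ ?_
  have := Submodule.eq_bot_of_le_smul_of_le_jacobson_bot _ _ (Module.Finite.fg_top (R := R)
    (M := M)) h.ge (IsLocalRing.maximalIdeal_le_jacobson _)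
  exact bot_ne_top this.symm

omit [IsNoetherianRing R] in
lemma support_residueField : Module.support R (ResidueField R) =
    PrimeSpectrum.zeroLocus (maximalIdeal R) := by
  have : Module.annihilator R (ResidueField R) = maximalIdeal R :=
    Ideal.annihilator_quotient
  have hfin : Module.Finite R (ResidueField R) := inferInstance
  rw [Module.support_eq_zeroLocus, this]

instance : Nontrivial (ModuleCat.of R (ResidueField R)) :=
  inferInstanceAs (Nontrivial (ResidueField R))

instance : Module.Finite R (ModuleCat.of R (ResidueField R)) :=
  inferInstanceAs (Module.Finite R (ResidueField R))

/-- Rees's theorem. The `Ext` side is the one that behaves well in exact sequences. -/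
lemma depthGE_iff_exists_isRegular [Nontrivial M] {t : ℕ} : DepthGE R M t ↔
    ∃ rs : List R, rs.length = t ∧ (∀ r ∈ rs, r ∈ maximalIdeal R) ∧ IsRegular M rs := by
  constructor
  · intro h
    exact ModuleCat.exists_isRegular_of_exists_subsingleton_ext (maximalIdeal R) t
      (ModuleCat.of R M) maximalIdeal_smul_top_lt (ModuleCat.of R (ResidueField R))
      support_residueField h
  · rintro ⟨rs, rfl, hmem, hreg⟩
    exact ModuleCat.subsingleton_ext_of_exists_isRegular (maximalIdeal R)
      (ModuleCat.of R (ResidueField R)) support_residueField.le (ModuleCat.of R M)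
      maximalIdeal_smul_top_lt rs hmem hreg

/-- Depth can be tested on all finitely generated modules killed by a power of `m`. -/
lemma DepthGE.extVanishes [Nontrivial M] {t : ℕ} (h : DepthGE R M t) {L : Type u}
    [AddCommGroup L] [Module R L] [Module.Finite R L] {n : ℕ}
    (hL : maximalIdeal R ^ n ≤ Module.annihilator R L) {i : ℕ} (hi : i < t) :
    ExtVanishes R L M i := by
  obtain ⟨rs, rfl, hmem, hreg⟩ := depthGE_iff_exists_isRegular.mp h
  refine ModuleCat.subsingleton_ext_of_exists_isRegular (maximalIdeal R)
      (ModuleCat.of R L) ?_ (ModuleCat.of R M) maximalIdeal_smul_top_lt rs hmem hreg i hi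
  intro p hp
  rw [Module.support_eq_zeroLocus] at hp
  exact fun x hx ↦ p.2.mem_of_pow_mem n (hp (hL (Ideal.pow_mem_pow hx n)))

lemma depthGE_of_le_depth [Nontrivial M] {t : ℕ} (h : (t : ℕ∞) ≤ depth R M) :
    DepthGE R M t := by
  cases t with
  | zero => exact fun i hi ↦ absurd hi (Nat.not_lt_zero i)
  | succ t =>
    have h1 : (t : ℕ∞) < depth R M := lt_of_lt_of_le (by exact_mod_cast Nat.lt_succ_self t) h
    rw [depth] at h1
    obtain ⟨rs, h1⟩ := lt_iSup_iff.mp h1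
    obtain ⟨⟨hmem, hreg⟩, h1⟩ := lt_iSup_iff.mp h1
    exact (depthGE_iff_exists_isRegular.mpr ⟨rs, rfl, hmem, hreg⟩).mono (by exact_mod_cast h1)

lemma DepthGE.exists_isSMulRegular {t : ℕ} (h : DepthGE R M (t + 1)) :
    ∃ x ∈ maximalIdeal R, IsSMulRegular M x := by
  have h1 : Subsingleton (ResidueField R →ₗ[R] M) :=
    ⟨fun a b ↦ (extVanishes_zero_iff.mp (h 0 (by omega)) a).trans
      (extVanishes_zero_iff.mp (h 0 (by omega)) b).symm⟩
  obtain ⟨x, hx, hreg⟩ := IsSMulRegular.subsingleton_linearMap_iff.mp h1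
  have : Module.annihilator R (ResidueField R) = maximalIdeal R := Ideal.annihilator_quotient
  exact ⟨x, this ▸ hx, hreg⟩

/-- If `x ∈ m` is `M`-regular, every associated prime of `M` lies in an associated prime of
`M / x M` containing `x`. -/
lemma exists_associatedPrime_quotSMulTop {x : R} (hx : x ∈ maximalIdeal R)
    (hreg : IsSMulRegular M x) {q : Ideal R} (hq : q ∈ associatedPrimes R M) :
    ∃ q' ∈ associatedPrimes R (QuotSMulTop x M), q ≤ q' ∧ x ∈ q' := by
  obtain ⟨hqp, y, rfl⟩ := isAssociatedPrime_iff.mp hq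
  have hy : y ≠ 0 := by
    rintro rfl
    exact hqp.ne_top (by simp)
  -- `N` consists of the elements killed by `q = ann y`. If `N ⊆ xM`, regularity of `x` gives `N =
  -- xN`, and Nakayama contradicts `y ≠ 0`. So some `z ∈ N` survives in `M/xM`, killed by `q` and
  -- `x`.
  let N : Submodule R M := Submodule.torsionBySet R M ((⊥ : Submodule R M).colon {y})
  have hyN : y ∈ N := by
    rw [Submodule.mem_torsionBySet_iff]
    rintro ⟨a, ha⟩
    simpa using ha
  obtain ⟨z, hzN, hz⟩ : ∃ z ∈ N, z ∉ x • (⊤ : Submodule R M) := by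
    by_contra! hcon
    have hle : N ≤ maximalIdeal R • N := by
      intro z hz
      obtain ⟨w, -, rfl⟩ := (Submodule.mem_smul_pointwise_iff_exists _ _ _).mp (hcon z hz)
      refine Submodule.smul_mem_smul hx ?_
      rw [Submodule.mem_torsionBySet_iff] at hz ⊢
      intro a
      refine hreg ?_
      have := hz a
      simp only [smul_zero]
      rw [smul_comm] at this
      exact this
    have := Submodule.eq_bot_of_le_smul_of_le_jacobson_bot _ _ (IsNoetherian.noetherian N) hle
      (IsLocalRing.maximalIdeal_le_jacobson _)
    rw [this] at hyN
    exact hy hyN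
  have hz' : (Submodule.Quotient.mk z : QuotSMulTop x M) ≠ 0 := by
    rwa [Ne, Submodule.Quotient.mk_eq_zero]
  obtain ⟨q', hq', hle⟩ := exists_le_isAssociatedPrime_of_isNoetherianRing R _ hz'
  refine ⟨q', hq', fun a ha ↦ hle ?_, hle ?_⟩
  · rw [Submodule.mem_colon_singleton, ← Submodule.Quotient.mk_smul,
      (Submodule.mem_torsionBySet_iff _ _).mp hzN ⟨a, ha⟩]
    simp
  · rw [Submodule.mem_colon_singleton, ← Submodule.Quotient.mk_smul, Submodule.mem_bot,
      Submodule.Quotient.mk_eq_zero]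
    exact Submodule.smul_mem_pointwise_smul _ _ _ trivial

end Finite

/-! ### Depth and the dimension of associated primes -/

omit [IsLocalRing R] [IsNoetherianRing R] in
lemma ringKrullDim_quotient_add_one_le {q q' : Ideal R} [q.IsPrime] (h : q < q') :
    ringKrullDim (R ⧸ q') + 1 ≤ ringKrullDim (R ⧸ q) := by
  obtain ⟨x, hx, hxq⟩ := SetLike.exists_of_lt h
  refine ringKrullDim_succ_le_of_surjective (Ideal.Quotient.factor h.le)
    (Ideal.Quotient.factor_surjective h.le) (r := Ideal.Quotient.mk q x) ?_ ?_
  · rw [mem_nonZeroDivisors_iff_ne_zero]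
    rwa [Ne, Ideal.Quotient.eq_zero_iff_mem]
  · simpa [Ideal.Quotient.eq_zero_iff_mem] using hx

omit [IsLocalRing R] [IsNoetherianRing R] in
lemma ringKrullDim_quotient_anti {q q' : Ideal R} (h : q ≤ q') :
    ringKrullDim (R ⧸ q') ≤ ringKrullDim (R ⧸ q) :=
  ringKrullDim_le_of_surjective (Ideal.Quotient.factor h) (Ideal.Quotient.factor_surjective h)

/-- The dimension of an associated prime is bounded below by the depth. -/
lemma DepthGE.le_ringKrullDim_quotient {M : Type u} [AddCommGroup M] [Module R M]
    [Module.Finite R M] {t : ℕ} (h : DepthGE R M t) {q : Ideal R}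
    (hq : q ∈ associatedPrimes R M) : (t : WithBot ℕ∞) ≤ ringKrullDim (R ⧸ q) := by
  induction t generalizing M q with
  | zero =>
    have := hq.isPrime
    have : Nontrivial (R ⧸ q) := Ideal.Quotient.nontrivial_iff.mpr this.ne_top
    exact ringKrullDim_nonneg_of_nontrivial
  | succ t ih =>
    obtain ⟨x, hx, hreg⟩ := h.exists_isSMulRegular
    obtain ⟨q', hq', hle, hxq'⟩ := exists_associatedPrime_quotSMulTop hx hreg hq
    have := hq.isPrime
    have hxq : x ∉ q := by
      have h1 : x ∉ ⋃ p ∈ associatedPrimes R M, (p : Set R) := by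
        rw [biUnion_associatedPrimes_eq_compl_regular]
        simpa using hreg
      intro h2
      exact h1 (Set.mem_biUnion hq h2)
    have hlt : q < q' := lt_of_le_of_ne hle (by rintro rfl; exact hxq hxq')
    refine le_trans ?_ (ringKrullDim_quotient_add_one_le hlt)
    push_cast
    gcongr
    exact ih (h.quotSMulTop hreg) hq'

/-! ### Regular sequences and Krull dimension -/

variable {d : ℕ} (hd : ringKrullDim R = d)

include hd

lemma exists_ringKrullDim_quotient_ofList {rs : List R} (hmem : ∀ r ∈ rs, r ∈ maximalIdeal R)
    (hreg : IsWeaklyRegular R rs) :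
    ∃ k : ℕ, ringKrullDim (R ⧸ Ideal.ofList rs) = k ∧ k + rs.length = d := by
  have h := ringKrullDim_add_length_eq_ringKrullDim_of_isRegular rs
    ((IsLocalRing.isRegular_iff_isWeaklyRegular_of_subset_maximalIdeal hmem).mpr hreg)
  rw [hd] at h
  generalize ringKrullDim (R ⧸ Ideal.ofList rs) = a at h
  induction a with
  | bot => simp at h
  | coe a =>
    induction a with
    | top =>
      have h' : (⊤ : ℕ∞) + rs.length = d := by exact_mod_cast h
      simp at h'
    | coe a => exact ⟨a, rfl, by exact_mod_cast h⟩

/-- An `R`-regular sequence is regular on every module of depth `dim R`. -/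
lemma DepthGE.isWeaklyRegular {M : Type u} [AddCommGroup M] [Module R M]
    [Module.Finite R M] (h : DepthGE R M d) {rs : List R}
    (hmem : ∀ r ∈ rs, r ∈ maximalIdeal R) (hreg : IsWeaklyRegular R rs) :
    IsWeaklyRegular M rs := by
  induction rs using List.reverseRecOn with
  | nil => exact .nil R M
  | append_singleton rs x ih =>
    have hreg' := ((isWeaklyRegular_append_iff R rs [x]).mp hreg).1
    have hmem' : ∀ r ∈ rs, r ∈ maximalIdeal R := fun r hr ↦ hmem r (by simp [hr])
    have ih := ih hmem' hreg'
    refine (isWeaklyRegular_append_iff M rs [x]).mpr ⟨ih, ?_⟩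
    rw [isWeaklyRegular_singleton_iff]
    obtain ⟨k, hk, hkd⟩ := exists_ringKrullDim_quotient_ofList hd hmem hreg
    rw [List.length_append, List.length_singleton] at hkd
    have hdep : DepthGE R (M ⧸ (Ideal.ofList rs • ⊤ : Submodule R M)) (k + 1) :=
      DepthGE.quotient_of_isWeaklyRegular rs ih (h.mono (by omega))
    -- A zero divisor `x` lies in an associated prime `q ⊇ (rs, x)` of `M/(rs)M`, whence `k + 1 ≤
    -- dim R/q ≤ dim R/(rs, x) = k`.
    by_contra hcon
    have hx : x ∈ ⋃ p ∈ associatedPrimes R (M ⧸ (Ideal.ofList rs • ⊤ : Submodule R M)),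
        (p : Set R) := by
      rw [biUnion_associatedPrimes_eq_compl_regular]
      exact hcon
    obtain ⟨q, hq, hxq⟩ := Set.mem_iUnion₂.mp hx
    have h1 := hdep.le_ringKrullDim_quotient hq
    have hle : Ideal.ofList (rs ++ [x]) ≤ q := by
      rw [Ideal.ofList_append, Ideal.ofList_singleton, sup_le_iff, Ideal.span_singleton_le_iff_mem]
      refine ⟨le_trans ?_ hq.annihilator_le, hxq⟩
      intro a ha
      rw [Submodule.mem_annihilator]
      intro y _
      obtain ⟨y, rfl⟩ := Submodule.Quotient.mk_surjective _ y
      rw [← Submodule.Quotient.mk_smul, Submodule.Quotient.mk_eq_zero]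
      exact Submodule.smul_mem_smul ha trivial
    have h2 := h1.trans ((ringKrullDim_quotient_anti hle).trans hk.le)
    have : k + 1 ≤ k := by exact_mod_cast h2
    omega

/-- In a Cohen-Macaulay local ring every prime `p` is associated to `R / (x)` for some regular
sequence `x` in `p`. -/
lemma DepthGE.exists_isWeaklyRegular_mem_associatedPrimes (h : DepthGE R R d) (p : Ideal R)
    [hp : p.IsPrime] : ∃ rs : List R, (∀ r ∈ rs, r ∈ p) ∧ IsWeaklyRegular R rs ∧
      p ∈ associatedPrimes R (R ⧸ (Ideal.ofList rs • ⊤ : Submodule R R)) := by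
  by_contra! hcon
  have hpm : p ≤ maximalIdeal R := le_maximalIdeal hp.ne_top
  -- If `p` is never associated, a regular sequence in `p` can always be prolonged inside `p`, which
  -- is absurd at length `d + 1`.
  have key : ∀ n : ℕ, ∃ rs : List R, (∀ r ∈ rs, r ∈ p) ∧ IsWeaklyRegular R rs ∧
      rs.length = n := by
    intro n
    induction n with
    | zero => exact ⟨[], by simp, .nil R R, rfl⟩
    | succ n ih =>
      obtain ⟨rs, hmem, hreg, rfl⟩ := ih
      obtain ⟨k, hk, hkd⟩ := exists_ringKrullDim_quotient_ofList hd
        (fun r hr ↦ hpm (hmem r hr)) hreg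
      have hdep : DepthGE R (R ⧸ (Ideal.ofList rs • ⊤ : Submodule R R)) k :=
        DepthGE.quotient_of_isWeaklyRegular rs hreg (h.mono (by omega))
      obtain ⟨x, hxp, hx⟩ : ∃ x ∈ p,
          IsSMulRegular (R ⧸ (Ideal.ofList rs • ⊤ : Submodule R R)) x := by
        by_contra! hno
        have hsub : (p : Set R) ⊆ ⋃ q ∈ associatedPrimes R
            (R ⧸ (Ideal.ofList rs • ⊤ : Submodule R R)), (id q : Ideal R) := by
          simp only [id]
          rw [biUnion_associatedPrimes_eq_compl_regular]
          exact fun x hx ↦ hno x hx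
        -- Prime avoidance. The two exceptional indices `0 0` are dummies, as every ideal in the
        -- family is prime.
        obtain ⟨q, hq, hpq⟩ := (Ideal.subset_union_prime_finite (associatedPrimes.finite R
          (R ⧸ (Ideal.ofList rs • ⊤ : Submodule R R))) 0 0 fun q hq _ _ ↦ hq.isPrime).mp hsub
        have hlt : p < q := lt_of_le_of_ne hpq (by rintro rfl; exact hcon rs hmem hreg hq)
        have h1 := hdep.le_ringKrullDim_quotient hq
        have h2 : Ideal.ofList rs ≤ p := Ideal.span_le.mpr hmem
        have h3 : ((k : ℕ) : WithBot ℕ∞) + 1 ≤ k := by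
          calc ((k : ℕ) : WithBot ℕ∞) + 1 ≤ ringKrullDim (R ⧸ q) + 1 := by gcongr
            _ ≤ ringKrullDim (R ⧸ p) := ringKrullDim_quotient_add_one_le hlt
            _ ≤ _ := ringKrullDim_quotient_anti h2
            _ = k := hk
        have : k + 1 ≤ k := by exact_mod_cast h3
        omega
      refine ⟨rs ++ [x], ?_, ?_, by simp⟩
      · simp only [List.mem_append, List.mem_singleton]
        rintro r (hr | rfl)
        exacts [hmem r hr, hxp]
      · rw [isWeaklyRegular_append_iff, isWeaklyRegular_singleton_iff]
        exact ⟨hreg, hx⟩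
  obtain ⟨rs, hmem, hreg, hlen⟩ := key (d + 1)
  obtain ⟨k, -, hkd⟩ := exists_ringKrullDim_quotient_ofList hd
    (fun r hr ↦ hpm (hmem r hr)) hreg
  omega

/-- Over a Cohen-Macaulay local ring of dimension `d`, finite injective dimension is at most `d`. -/
lemma DepthGE.fgInjDimLE (h : DepthGE R R d) {T : Type u} [AddCommGroup T] [Module R T]
    [Module.Finite R T] {n : ℕ} (hT : FgInjDimLE R T n) : FgInjDimLE R T d := by
  obtain ⟨rs, hmem, hreg, hass⟩ := h.exists_isWeaklyRegular_mem_associatedPrimes hd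
    (maximalIdeal R)
  obtain ⟨-, y, hy⟩ := isAssociatedPrime_iff.mp hass
  have hy0 : y ≠ 0 := by
    rintro rfl
    exact (maximalIdeal.isMaximal R).ne_top (by rw [hy]; simp)
  obtain ⟨ι, hι, -⟩ := exists_residueField_injective hy0 (fun a ha ↦ by
    rw [hy, Submodule.mem_colon_singleton] at ha
    simpa using ha)
  obtain ⟨k, -, hkd⟩ := exists_ringKrullDim_quotient_ofList hd hmem hreg
  intro L _ _ _ i hi
  exact hT.le_length_of_isWeaklyRegular hreg ι hι L i (by omega)

end Depth

/-! ### Splicing and cutting syzygy sequences -/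

section Syzygy

variable {R : Type u} [CommRing R]

lemma isSyzygy_zero (M : Type u) [AddCommGroup M] [Module R M] : IsSyzygy R M 0 :=
  ⟨fun _ ↦ ModuleCat.of R M, fun _ ↦ 0, ⟨LinearEquiv.refl R M⟩, by omega, by omega, by omega⟩

/-- Splicing: a submodule of a free module with `t`-syzygy quotient is a `(t + 1)`-syzygy. -/
lemma IsSyzygy.succ {M : Type u} [AddCommGroup M] [Module R M] {n t : ℕ}
    (f : M →ₗ[R] (Fin n → R)) (hf : Function.Injective f)
    (h : IsSyzygy R ((Fin n → R) ⧸ LinearMap.range f) t) : IsSyzygy R M (t + 1) := by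
  obtain ⟨X, g, ⟨e⟩, hX, hinj, hex⟩ := h
  -- `X 0`, a copy of the quotient, is absorbed into the composite map `R^n → X 1`.
  let Y : ℕ → ModuleCat.{u} R := fun
    | 0 => ModuleCat.of R M
    | 1 => ModuleCat.of R (Fin n → R)
    | i + 2 => X (i + 1)
  let φ : ∀ i, Y i →ₗ[R] Y (i + 1) := fun
    | 0 => f
    | 1 => g 0 ∘ₗ e.toLinearMap ∘ₗ (LinearMap.range f).mkQ
    | i + 2 => g (i + 1)
  refine ⟨Y, φ, ⟨LinearEquiv.refl R M⟩, ?_, fun _ ↦ hf, ?_⟩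
  · rintro (_ | _ | i) h1 h2
    · omega
    · exact ⟨n, LinearMap.id, LinearMap.id, rfl⟩
    · exact hX (i + 1) (by omega) (by omega)
  · rintro (_ | _ | i) h1
    · change Function.Exact f (g 0 ∘ₗ e.toLinearMap ∘ₗ (LinearMap.range f).mkQ)
      have := hinj (by omega)
      intro x
      rw [LinearMap.comp_apply, LinearMap.comp_apply, map_eq_zero_iff _ this]
      simp
    · change Function.Exact (g 0 ∘ₗ e.toLinearMap ∘ₗ (LinearMap.range f).mkQ) (g 1)
      have := hex 0 (by omega)
      intro x
      rw [this x]
      constructor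
      · rintro ⟨y, rfl⟩
        obtain ⟨y, rfl⟩ := e.surjective y
        obtain ⟨y, rfl⟩ := Submodule.mkQ_surjective _ y
        exact ⟨y, rfl⟩
      · rintro ⟨y, rfl⟩
        exact ⟨_, rfl⟩
    · exact hex (i + 1) (by omega)

/-- A `(t + 1)`-syzygy embeds in a finitely generated projective module with a `t`-syzygy
quotient. -/
lemma IsSyzygy.exists_embedding {M : Type u} [AddCommGroup M] [Module R M] {t : ℕ}
    (h : IsSyzygy R M (t + 1)) : ∃ (P : ModuleCat.{u} R) (f : M →ₗ[R] P),
      Module.Finite R P ∧ Module.Projective R P ∧ Function.Injective f ∧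
      IsSyzygy R (P ⧸ LinearMap.range f) t := by
  obtain ⟨X, g, ⟨e⟩, hX, hinj, hex⟩ := h
  obtain ⟨n, i, s, hs⟩ := hX 1 le_rfl (by omega)
  have hfin : Module.Finite R (X 1) := Module.Finite.of_surjective s fun x ↦ ⟨i x, congr($hs x)⟩
  have hproj : Module.Projective R (X 1) := Module.Projective.of_split i s hs
  refine ⟨X 1, g 0 ∘ₗ e.toLinearMap, hfin, hproj,
    (hinj (by omega)).comp e.injective, ?_⟩
  cases t with
  | zero => exact isSyzygy_zero _
  | succ t =>
    have h0 := hex 0 (by omega)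
    have hr : LinearMap.range (g 0 ∘ₗ e.toLinearMap) = LinearMap.ker (g 1) := by
      rw [LinearMap.range_comp_of_range_eq_top _ (LinearEquiv.range e)]
      exact h0.linearMap_ker_eq.symm
    let Q := X 1 ⧸ LinearMap.range (g 0 ∘ₗ e.toLinearMap)
    let q : Q →ₗ[R] X 2 := Submodule.liftQ _ (g 1) hr.le
    have hqi : Function.Injective q := by
      rw [← LinearMap.ker_eq_bot]
      exact Submodule.ker_liftQ_eq_bot _ _ _ hr.ge
    let Y : ℕ → ModuleCat.{u} R := fun
      | 0 => ModuleCat.of R Q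
      | i + 1 => X (i + 2)
    let φ : ∀ i, Y i →ₗ[R] Y (i + 1) := fun
      | 0 => q
      | i + 1 => g (i + 2)
    refine ⟨Y, φ, ⟨LinearEquiv.refl R Q⟩, ?_, fun _ ↦ hqi, ?_⟩
    · rintro (_ | i) h1 h2
      · omega
      · exact hX (i + 2) (by omega) (by omega)
    · rintro (_ | i) h1
      · change Function.Exact q (g 2)
        have h1 := hex 1 (by omega)
        intro x
        rw [h1 x]
        constructor
        · rintro ⟨y, rfl⟩
          exact ⟨Submodule.Quotient.mk y, rfl⟩
        · rintro ⟨y, rfl⟩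
          obtain ⟨y, rfl⟩ := Submodule.mkQ_surjective _ y
          exact ⟨y, rfl⟩
      · exact hex (i + 2) (by omega)

end Syzygy

/-! ### Localizing modules and maps at a prime -/

section Localization

variable {R : Type u} [CommRing R] (p : Ideal R) [p.IsPrime]
  {A B C : Type u} [AddCommGroup A] [Module R A] [AddCommGroup B] [Module R B]
  [AddCommGroup C] [Module R C]

/-- The localization of a linear map at a prime. -/
noncomputable abbrev locMap (f : A →ₗ[R] B) : LocalizedModule p.primeCompl A
    →ₗ[Localization.AtPrime p] LocalizedModule p.primeCompl B :=
  IsLocalizedModule.mapExtendScalars p.primeCompl (LocalizedModule.mkLinearMap p.primeCompl A)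
    (LocalizedModule.mkLinearMap p.primeCompl B) (Localization.AtPrime p) f

lemma locMap_mkLinearMap (f : A →ₗ[R] B) (x : A) :
    locMap p f (LocalizedModule.mkLinearMap p.primeCompl A x) =
      LocalizedModule.mkLinearMap p.primeCompl B (f x) :=
  IsLocalizedModule.map_apply p.primeCompl _ _ f x

lemma locMap_injective {f : A →ₗ[R] B} (hf : Function.Injective f) :
    Function.Injective (locMap p f) :=
  IsLocalizedModule.map_injective p.primeCompl _ _ f hf

lemma locMap_surjective {f : A →ₗ[R] B} (hf : Function.Surjective f) :
    Function.Surjective (locMap p f) :=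
  IsLocalizedModule.map_surjective p.primeCompl _ _ f hf

lemma locMap_exact {f : A →ₗ[R] B} {g : B →ₗ[R] C} (h : Function.Exact f g) :
    Function.Exact (locMap p f) (locMap p g) :=
  IsLocalizedModule.map_exact p.primeCompl _ _ _ f g h

lemma linearMap_localizedModule_ext {N : Type*} [AddCommGroup N] [Module R N]
    [Module (Localization.AtPrime p) N] [IsScalarTower R (Localization.AtPrime p) N]
    {φ ψ : LocalizedModule p.primeCompl A →ₗ[Localization.AtPrime p] N}
    (h : ∀ x : A, φ (LocalizedModule.mkLinearMap p.primeCompl A x) =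
      ψ (LocalizedModule.mkLinearMap p.primeCompl A x)) : φ = ψ := by
  ext z
  obtain ⟨⟨x, s⟩, rfl⟩ := IsLocalizedModule.mk'_surjective p.primeCompl
    (LocalizedModule.mkLinearMap p.primeCompl A) z
  have hu : IsUnit (algebraMap R (Localization.AtPrime p) s) :=
    IsLocalization.map_units (Localization.AtPrime p) s
  refine hu.smul_left_cancel.mp ?_
  rw [← map_smul, ← map_smul, algebraMap_smul]
  have hz := IsLocalizedModule.mk'_cancel' (LocalizedModule.mkLinearMap p.primeCompl A) x s
  rw [Submonoid.smul_def] at hz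
  rw [Function.uncurry_apply_pair, hz, h]

/-- An element annihilated by `p` is, after localization, annihilated by the maximal ideal. -/
lemma maximalIdeal_smul_eq_zero {N : Type*} [AddCommGroup N] [Module R N]
    [Module (Localization.AtPrime p) N] [IsScalarTower R (Localization.AtPrime p) N] {z : N}
    (h : ∀ a ∈ p, a • z = 0) : ∀ a ∈ maximalIdeal (Localization.AtPrime p), a • z = 0 := by
  have hle : maximalIdeal (Localization.AtPrime p) ≤
      LinearMap.ker (LinearMap.toSpanSingleton (Localization.AtPrime p) N z) := by
    rw [← Localization.AtPrime.map_eq_maximalIdeal, Ideal.map_le_iff_le_comap]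
    intro a ha
    rw [Ideal.mem_comap, LinearMap.mem_ker, LinearMap.toSpanSingleton_apply, algebraMap_smul]
    exact h a ha
  exact fun a ha ↦ hle ha

/-- Every map `M_p → N_p` is a fraction of a localized map, for `M` finitely presented. -/
lemma exists_smul_eq_locMap [Module.FinitePresentation R A]
    (φ : LocalizedModule p.primeCompl A →ₗ[Localization.AtPrime p]
      LocalizedModule p.primeCompl B) :
    ∃ (f : A →ₗ[R] B) (s : Localization.AtPrime p), IsUnit s ∧ s • φ = locMap p f := by
  obtain ⟨f, s, hf⟩ := Module.FinitePresentation.exists_lift_of_isLocalizedModule p.primeCompl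
    (LocalizedModule.mkLinearMap p.primeCompl B)
    (φ.restrictScalars R ∘ₗ LocalizedModule.mkLinearMap p.primeCompl A)
  refine ⟨f, algebraMap R _ s, IsLocalization.map_units (Localization.AtPrime p) s,
    linearMap_localizedModule_ext p fun x ↦ ?_⟩
  rw [locMap_mkLinearMap, LinearMap.smul_apply, algebraMap_smul]
  exact congr($hf x).symm

end Localization

/-! ### Free approximations on a Gorenstein punctured spectrum -/

section Approximation

variable {R : Type u} [CommRing R] [IsLocalRing R] [IsNoetherianRing R]

/-- `Ext^i(M_p, R_p) = 0` for all `i > 0` and all non-maximal primes `p`. -/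
def LocallyExtVanishes (R : Type u) [CommRing R] [IsLocalRing R] (M : Type u) [AddCommGroup M]
    [Module R M] : Prop :=
  ∀ (p : Ideal R) [p.IsPrime], p ≠ maximalIdeal R → ∀ i, 0 < i →
    ExtVanishes (Localization.AtPrime p) (LocalizedModule p.primeCompl M)
      (LocalizedModule p.primeCompl R) i

omit [IsLocalRing R] in
/-- The left approximation of a finitely generated module by a free module. -/
lemma exists_linearMap_factor (M : Type u) [AddCommGroup M] [Module R M] [Module.Finite R M] :
    ∃ (n : ℕ) (f : M →ₗ[R] (Fin n → R)),
      ∀ φ : M →ₗ[R] R, ∃ c : (Fin n → R) →ₗ[R] R, c ∘ₗ f = φ := by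
  -- The coordinates of `f` are generators of the dual of `M`.
  obtain ⟨n, π, hπ⟩ := Module.Finite.exists_fin' R (M →ₗ[R] R)
  refine ⟨n, LinearMap.pi fun i ↦ π (Pi.single i 1), fun φ ↦ ?_⟩
  obtain ⟨c, rfl⟩ := hπ φ
  refine ⟨∑ i, c i • LinearMap.proj i, LinearMap.ext fun x ↦ ?_⟩
  conv_rhs => rw [pi_eq_sum_univ' c, map_sum]
  simp [LinearMap.sum_apply]

omit [IsLocalRing R] in
/-- The localization of a left free approximation is a left approximation. -/
lemma exists_extend_locMap (p : Ideal R) [p.IsPrime] {M : Type u} [AddCommGroup M] [Module R M]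
    [Module.Finite R M] {n : ℕ} {f : M →ₗ[R] (Fin n → R)}
    (hf : ∀ φ : M →ₗ[R] R, ∃ c : (Fin n → R) →ₗ[R] R, c ∘ₗ f = φ)
    (φ : LocalizedModule p.primeCompl M →ₗ[Localization.AtPrime p]
      LocalizedModule p.primeCompl R) :
    ∃ ψ : LocalizedModule p.primeCompl (Fin n → R) →ₗ[Localization.AtPrime p]
      LocalizedModule p.primeCompl R, ψ ∘ₗ locMap p f = φ := by
  have := Module.finitePresentation_of_finite R M
  obtain ⟨g, s, hs, hg⟩ := exists_smul_eq_locMap p φ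
  obtain ⟨c, rfl⟩ := hf g
  obtain ⟨s, rfl⟩ := hs
  refine ⟨(↑s⁻¹ : Localization.AtPrime p) • locMap p c, ?_⟩
  have h1 : locMap p (c ∘ₗ f) = locMap p c ∘ₗ locMap p f :=
    linearMap_localizedModule_ext p fun x ↦ by
      rw [LinearMap.comp_apply, locMap_mkLinearMap, locMap_mkLinearMap, locMap_mkLinearMap]
      rfl
  rw [LinearMap.smul_comp, ← h1, ← hg, smul_smul, Units.inv_mul, one_smul]

/-- An associated prime of the kernel is excluded by depth if it is `m`. Otherwise a map to `R_p`
nonzero on the corresponding socle element would factor through `f_p`, which kills that element. -/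
lemma injective_of_locallyExtVanishes
    (hG : ∀ (p : Ideal R) [p.IsPrime], p ≠ maximalIdeal R →
      HasFiniteInjectiveDimension (Localization.AtPrime p) (LocalizedModule p.primeCompl R))
    {M : Type u} [AddCommGroup M] [Module R M] [Module.Finite R M] {t : ℕ}
    (hdep : DepthGE R M (t + 1)) (hM : LocallyExtVanishes R M) {n : ℕ}
    {f : M →ₗ[R] (Fin n → R)}
    (hf : ∀ φ : M →ₗ[R] R, ∃ c : (Fin n → R) →ₗ[R] R, c ∘ₗ f = φ) :
    Function.Injective f := by
  rw [← LinearMap.ker_eq_bot]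
  by_contra hK
  have : Nontrivial (LinearMap.ker f) := Submodule.nontrivial_iff_ne_bot.mpr hK
  obtain ⟨p, hp⟩ := associatedPrimes.nonempty R (LinearMap.ker f)
  obtain ⟨hpp, ⟨y, hyK⟩, hy⟩ := isAssociatedPrime_iff.mp hp
  have hpy : ∀ a, a ∈ p ↔ a • y = 0 := by
    intro a
    rw [hy, Submodule.mem_colon_singleton, Submodule.mem_bot, ← Submodule.coe_eq_zero]
    rfl
  by_cases hpm : p = maximalIdeal R
  · have hy0 : y = 0 := hdep.eq_zero_of_smul_eq_zero fun a ha ↦ (hpy a).mp (hpm ▸ ha)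
    exact hpp.ne_top ((Ideal.eq_top_iff_one _).mpr ((hpy 1).mpr (by simp [hy0])))
  obtain ⟨m, hm⟩ := (hG p hpm).exists_fgInjDimLE
  have : Nontrivial (LocalizedModule p.primeCompl R) :=
    (IsLocalizedModule.linearEquiv p.primeCompl (LocalizedModule.mkLinearMap p.primeCompl R)
      (Algebra.linearMap R (Localization.AtPrime p))).toEquiv.nontrivial
  let y' := LocalizedModule.mkLinearMap p.primeCompl M y
  have hy' : y' ≠ 0 := by
    intro h0
    obtain ⟨s, hs⟩ := (IsLocalizedModule.eq_zero_iff p.primeCompl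
      (LocalizedModule.mkLinearMap p.primeCompl M)).mp h0
    exact s.2 ((hpy s).mpr hs)
  obtain ⟨φ, hφ⟩ := hm.exists_apply_ne_zero (hM p hpm) hy' (maximalIdeal_smul_eq_zero p
    fun a ha ↦ by rw [← map_smul, (hpy a).mp ha, map_zero])
  obtain ⟨ψ, rfl⟩ := exists_extend_locMap p hf φ
  refine hφ ?_
  rw [LinearMap.comp_apply, locMap_mkLinearMap, LinearMap.mem_ker.mp hyK, map_zero, map_zero]

/-- Degree one is the extension property of `f_p`; higher degrees are dimension shifting. This keeps
the induction on syzygies going. -/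
lemma LocallyExtVanishes.quotient {M : Type u} [AddCommGroup M] [Module R M]
    [Module.Finite R M] (hM : LocallyExtVanishes R M) {n : ℕ} {f : M →ₗ[R] (Fin n → R)}
    (hinj : Function.Injective f)
    (hf : ∀ φ : M →ₗ[R] R, ∃ c : (Fin n → R) →ₗ[R] R, c ∘ₗ f = φ) :
    LocallyExtVanishes R ((Fin n → R) ⧸ LinearMap.range f) := by
  intro p _ hpm i hi
  have hex := locMap_exact p f.exact_map_mkQ_range
  have hsurj := locMap_surjective p (Submodule.mkQ_surjective (LinearMap.range f))
  obtain _ | _ | i := i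
  · omega
  · exact ExtVanishes.one_of_forall_extend hex (locMap_injective p hinj) hsurj
      ExtVanishes.of_projective (exists_extend_locMap p hf)
  · exact ExtVanishes.of_exact_right hex (locMap_injective p hinj) hsurj
      (hM p hpm (i + 1) (by omega)) ExtVanishes.of_projective

/-- If `R` is Gorenstein on the punctured spectrum, modules of sufficient depth which are locally
`Ext(-, R)`-acyclic on the punctured spectrum are syzygies. -/
theorem LocallyExtVanishes.isSyzygy
    (hG : ∀ (p : Ideal R) [p.IsPrime], p ≠ maximalIdeal R →
      HasFiniteInjectiveDimension (Localization.AtPrime p) (LocalizedModule p.primeCompl R))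
    {t : ℕ} (hR : DepthGE R R t) {M : Type u} [AddCommGroup M] [Module R M] [Module.Finite R M]
    (hdep : DepthGE R M t) (hM : LocallyExtVanishes R M) : IsSyzygy R M t := by
  induction t generalizing M with
  | zero => exact isSyzygy_zero M
  | succ t ih =>
    obtain ⟨n, f, hf⟩ := exists_linearMap_factor (R := R) M
    have hinj := injective_of_locallyExtVanishes hG hdep hM hf
    exact .succ f hinj (ih (hR.mono (by omega))
      (.of_exact_right f.exact_map_mkQ_range hinj (Submodule.mkQ_surjective _) hdep
        (hR.mono (by omega)).pi) (hM.quotient hinj hf))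

open RingTheory.Sequence in
/-- Modules of maximal depth are `Ext(-, R_p)`-acyclic at all primes where the Cohen-Macaulay ring
`R` is Gorenstein. -/
lemma extVanishes_localization {d : ℕ} (hd : ringKrullDim R = d) (hR : DepthGE R R d)
    {M : Type u} [AddCommGroup M] [Module R M] [Module.Finite R M] (hM : DepthGE R M d)
    (p : Ideal R) [p.IsPrime]
    (hG : HasFiniteInjectiveDimension (Localization.AtPrime p) (LocalizedModule p.primeCompl R))
    {i : ℕ} (hi : 0 < i) : ExtVanishes (Localization.AtPrime p) (LocalizedModule p.primeCompl M)
      (LocalizedModule p.primeCompl R) i := by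
  obtain ⟨rs, hmem, hreg, hass⟩ := hR.exists_isWeaklyRegular_mem_associatedPrimes hd p
  have hregM := hM.isWeaklyRegular hd
    (fun r hr ↦ le_maximalIdeal (Ideal.IsPrime.ne_top ‹_›) (hmem r hr)) hreg
  obtain ⟨n, hn⟩ := hG.exists_fgInjDimLE
  let S := Localization.AtPrime p
  let rs' := rs.map (algebraMap R S)
  have hregS : IsWeaklyRegular S rs' := hreg.of_isLocalization S p.primeCompl
  have hregMS : IsWeaklyRegular (LocalizedModule p.primeCompl M) rs' :=
    hregM.of_isLocalizedModule S p.primeCompl (LocalizedModule.mkLinearMap p.primeCompl M)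
  -- A generator `y` of a copy of `R/p` in `R/(rs)` localizes to a nonzero socle element of
  -- `R_p/(rs)`. This bounds the injective dimension of `R_p` by `rs.length`.
  obtain ⟨-, y, hy⟩ := isAssociatedPrime_iff.mp hass
  obtain ⟨y, rfl⟩ := Submodule.mkQ_surjective _ y
  have hpy : ∀ a, a ∈ p ↔ a * y ∈ Ideal.ofList rs := by
    intro a
    rw [hy, Submodule.mem_colon_singleton, Submodule.mem_bot, ← map_smul, Submodule.mkQ_apply,
      Submodule.Quotient.mk_eq_zero]
    simp
  have hmap : Ideal.ofList rs' = (Ideal.ofList rs).map (algebraMap R S) :=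
    (Ideal.map_ofList _ _).symm
  let y' : S ⧸ (Ideal.ofList rs' • ⊤ : Submodule S S) := Submodule.Quotient.mk (algebraMap R S y)
  have hy' : y' ≠ 0 := by
    intro h0
    have h1 : algebraMap R S y ∈ Ideal.ofList rs' := by
      have := (Submodule.Quotient.mk_eq_zero _).mp h0
      simpa using this
    rw [hmap, IsLocalization.algebraMap_mem_map_algebraMap_iff p.primeCompl] at h1
    obtain ⟨s, hs, hsy⟩ := h1
    exact hs ((hpy s).mpr hsy)
  have hker : ∀ a ∈ maximalIdeal S, a • y' = 0 := by
    intro a ha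
    rw [← Localization.AtPrime.map_eq_maximalIdeal] at ha
    rw [← Submodule.Quotient.mk_smul, Submodule.Quotient.mk_eq_zero, smul_eq_mul]
    have hle : p.map (algebraMap R S) ≤
        LinearMap.ker ((Ideal.ofList rs' • ⊤ : Submodule S S).mkQ ∘ₗ
          LinearMap.toSpanSingleton S S (algebraMap R S y)) := by
      rw [Ideal.map_le_iff_le_comap]
      intro b hb
      rw [Ideal.mem_comap, LinearMap.mem_ker, LinearMap.comp_apply,
        LinearMap.toSpanSingleton_apply, Submodule.mkQ_apply, Submodule.Quotient.mk_eq_zero,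
        smul_eq_mul, Ideal.mul_top, hmap, smul_eq_mul, ← map_mul]
      exact Ideal.mem_map_of_mem _ ((hpy b).mp hb)
    have := hle ha
    rwa [LinearMap.mem_ker, LinearMap.comp_apply,
        LinearMap.toSpanSingleton_apply, Submodule.mkQ_apply, Submodule.Quotient.mk_eq_zero,
        smul_eq_mul] at this
  obtain ⟨ι, hι, -⟩ := exists_residueField_injective hy' hker
  have hS := hn.le_length_of_isWeaklyRegular hregS ι hι
  -- The same sequence is regular on `M_p`, and its length cancels the bound: hence `c := 0`.
  refine FgInjDimLE.extVanishes_of_isWeaklyRegular (c := 0) rs' ?_ hregMS (by simpa using hS) i hi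
  intro r hr
  obtain ⟨b, hb, rfl⟩ := List.mem_map.mp hr
  rw [← Localization.AtPrime.map_eq_maximalIdeal]
  exact Ideal.mem_map_of_mem _ (hmem b hb)

end Approximation

/-! ### Torsion in the top `Ext`, and faithfulness -/

section Torsion

variable {R : Type u} [CommRing R] [IsLocalRing R] [IsNoetherianRing R]
  {T : Type u} [AddCommGroup T] [Module R T] [Module.Finite R T]

/-- The top `Ext` into a module of injective dimension `d` is `s`-power torsion for `s ∈ m`. -/
lemma FgInjDimLE.exists_pow_smul_eq_zero {d : ℕ} (hT : FgInjDimLE R T d) {s : R}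
    (hs : s ∈ maximalIdeal R) (N : Type u) [AddCommGroup N] [Module R N] [Module.Finite R N] :
    ∃ t : ℕ, ∀ x : Ext (ModuleCat.of R N) (ModuleCat.of R T) d, s ^ t • x = 0 := by
  let g : N →ₗ[R] N := LinearMap.lsmul R N s
  have hg : ∀ (n : ℕ) (y : N), (g ^ n) y = s ^ n • y := by
    intro n
    induction n with
    | zero => simp
    | succ n ih =>
      intro y
      rw [pow_succ', Module.End.mul_apply, ih, pow_succ', mul_smul]
      rfl
  -- Once the kernels of the powers of `s` stabilize, `s` is regular on `N / ker s^n`, so `Ext^d` of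
  -- that quotient vanishes and `Ext^d(N, T)` embeds in `Ext^d(ker s^n, T)`, killed by `s^n`.
  obtain ⟨n, hn⟩ := monotone_stabilizes_iff_noetherian.mpr
    (inferInstance : IsNoetherian R N) (LinearMap.iterateKer g)
  have hn' : LinearMap.ker (g ^ n) = LinearMap.ker (g ^ (n + 1)) := hn (n + 1) (by omega)
  have hreg : IsSMulRegular (N ⧸ LinearMap.ker (g ^ n)) s := by
    rw [isSMulRegular_quotient_iff_mem_of_smul_mem]
    intro y hy
    rw [hn', LinearMap.mem_ker, hg, pow_succ, mul_smul]
    rwa [LinearMap.mem_ker, hg] at hy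
  have hC : ExtVanishes R (N ⧸ LinearMap.ker (g ^ n)) T d :=
    .of_isSMulRegular hs hreg (hT _ _ (by omega))
  refine ⟨n, fun x ↦ extMap_injective_left (LinearMap.exact_subtype_mkQ (LinearMap.ker (g ^ n)))
    (Submodule.injective_subtype _) (Submodule.mkQ_surjective _) hC ?_⟩
  rw [map_smul, map_zero]
  refine smul_ext_eq_zero_of_forall_smul_eq_zero_left (fun y ↦ ?_) _
  have hy := y.2
  rw [LinearMap.mem_ker, hg] at hy
  exact Subtype.ext hy

/-- Each cosyzygy step embeds `Ext^i` in `Ext^{i+1}` of the quotient (here `0 < i` is needed), until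
degree `d` or beyond is reached. -/
lemma FgInjDimLE.exists_pow_smul_eq_zero_of_isSyzygy {d : ℕ} (hT : FgInjDimLE R T d) {s : R}
    (hs : s ∈ maximalIdeal R) {j : ℕ} (N : Type u) [AddCommGroup N] [Module R N]
    [Module.Finite R N] (hN : IsSyzygy R N j) {i : ℕ} (hi : 0 < i) (hij : d ≤ i + j) :
    ∃ t : ℕ, ∀ x : Ext (ModuleCat.of R N) (ModuleCat.of R T) i, s ^ t • x = 0 := by
  induction j generalizing N i with
  | zero =>
    obtain rfl | hlt := Nat.eq_or_lt_of_le (show d ≤ i by omega)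
    · exact hT.exists_pow_smul_eq_zero hs N
    · exact ⟨0, fun x ↦ (hT N i hlt).elim _ _⟩
  | succ j ih =>
    obtain ⟨P, f, hfin, hproj, hf, hC⟩ := hN.exists_embedding
    obtain ⟨t, ht⟩ := ih _ hC (i := i + 1) (by omega) (by omega)
    obtain ⟨i, rfl⟩ : ∃ k, i = k + 1 := ⟨i - 1, by omega⟩
    exact ⟨t, smul_ext_eq_zero_of_exact f.exact_map_mkQ_range hf (Submodule.mkQ_surjective _)
      .of_projective ht⟩

/-- `Ext^{e+1}(L, T)` does not vanish for `L ≠ 0` killed by a power of `m`, if `T` has depth at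
least `e + 1` and `Ext^{e+1}(k, T) ≠ 0`. -/
lemma DepthGE.not_extVanishes [Nontrivial T] {e : ℕ} (hdep : DepthGE R T (e + 1))
    (hk : ¬ ExtVanishes R (ResidueField R) T (e + 1)) {L : Type u} [AddCommGroup L] [Module R L]
    [Module.Finite R L] [Nontrivial L] {n : ℕ}
    (hL : maximalIdeal R ^ n ≤ Module.annihilator R L) : ¬ ExtVanishes R L T (e + 1) := by
  intro hV
  -- A simple quotient of `L` is `k`, and `Ext^{e+1}(k, T)` embeds in `Ext^{e+1}(L, T)` because
  -- `Ext^e(N, T) = 0`.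
  obtain ⟨N, hN⟩ := IsCoatomic.exists_coatom (Submodule R L)
  have hsimple : IsSimpleModule R (L ⧸ N) := isSimpleModule_iff_isCoatom.mpr hN
  obtain ⟨I, hI, ⟨e'⟩⟩ := isSimpleModule_iff_quot_maximal.mp hsimple
  obtain rfl := IsLocalRing.eq_maximalIdeal hI
  refine hk (ExtVanishes.congr (N := L ⧸ N) e' (LinearEquiv.refl R T) ?_)
  have := extMap_injective (T := T) (LinearMap.exact_subtype_mkQ N) N.injective_subtype
    N.mkQ_surjective (i := e) (hdep.extVanishes (hL.trans (N.subtype.annihilator_le_of_injective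
        N.injective_subtype)) (by omega))
  exact subsingleton_of_forall_eq 0 fun y ↦ this (hV.elim _ _)

/-- On modules killed by a power of `m`, `Ext^{e+1}(-, T)` is exact and kills no nonzero module.
Factoring multiplication by `a` as `L ↠ aL ↪ L`, its action on `Ext^{e+1}` is zero, so
`Ext^{e+1}(aL, T) = 0` and `aL = 0`. -/
lemma FgInjDimLE.smul_eq_zero_of_mem_annihilator [Nontrivial T] {e : ℕ}
    (hT : FgInjDimLE R T (e + 1)) (hdep : DepthGE R T (e + 1))
    (hk : ¬ ExtVanishes R (ResidueField R) T (e + 1)) {a : R} (ha : a ∈ Module.annihilator R T)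
    {L : Type u} [AddCommGroup L] [Module R L] [Module.Finite R L] {n : ℕ}
    (hL : maximalIdeal R ^ n ≤ Module.annihilator R L) (x : L) : a • x = 0 := by
  by_contra hx
  have hsub (N : Submodule R L) : maximalIdeal R ^ n ≤ Module.annihilator R N :=
    hL.trans (N.subtype.annihilator_le_of_injective N.injective_subtype)
  let g : L →ₗ[R] L := a • LinearMap.id
  have hne : Nontrivial (LinearMap.range g) := by
    rw [Submodule.nontrivial_iff_ne_bot, Ne, LinearMap.range_eq_bot]
    exact fun h0 ↦ hx congr($h0 x)
  refine hdep.not_extVanishes hk (hsub (LinearMap.range g)) ?_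
  refine subsingleton_of_forall_eq 0 fun y ↦ ?_
  obtain ⟨x, rfl⟩ := extMap_surjective (LinearMap.exact_subtype_mkQ (LinearMap.range g))
    (Submodule.injective_subtype _) (Submodule.mkQ_surjective _) (hT _ _ (by omega)) y
  refine extMap_injective (LinearMap.exact_subtype_ker_map g.rangeRestrict)
    (Submodule.injective_subtype _) g.surjective_rangeRestrict (i := e)
    (hdep.extVanishes (hsub _) (by omega)) ?_
  have hg : (LinearMap.range g).subtype ∘ₗ g.rangeRestrict = a • LinearMap.id := rfl
  rw [← extMap_comp, hg, extMap_smul_id, map_zero]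
  exact smul_ext_eq_zero_of_forall_smul_eq_zero (Module.mem_annihilator.mp ha) x

/-- A nonzero module with depth and injective dimension `e + 1` is faithful. -/
lemma FgInjDimLE.annihilator_eq_bot [Nontrivial T] {e : ℕ} (hT : FgInjDimLE R T (e + 1))
    (hdep : DepthGE R T (e + 1)) (hk : ¬ ExtVanishes R (ResidueField R) T (e + 1)) :
    Module.annihilator R T = ⊥ := by
  rw [eq_bot_iff, ← Ideal.iInf_pow_eq_bot_of_isLocalRing (maximalIdeal R)
      (maximalIdeal.isMaximal R).ne_top]
  refine le_iInf fun n a ha ↦ ?_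
  have hL : maximalIdeal R ^ n ≤ Module.annihilator R (R ⧸ maximalIdeal R ^ n) :=
    Ideal.annihilator_quotient.ge
  have := hT.smul_eq_zero_of_mem_annihilator hdep hk ha hL (Ideal.Quotient.mk _ 1)
  rw [← Ideal.Quotient.eq_zero_iff_mem, ← this]
  change _ = Ideal.Quotient.mk _ (a • 1)
  simp

end Torsion

/-! ### Finite injective dimension under retracts and localization -/

section InjectiveDimension

lemma HasFiniteInjectiveDimension.of_retract {R : Type u} [CommRing R] {A B : Type u}
    [AddCommGroup A] [Module R A] [AddCommGroup B] [Module R B]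
    (h : HasFiniteInjectiveDimension R B) (i : A →ₗ[R] B) (r : B →ₗ[R] A)
    (hr : r ∘ₗ i = LinearMap.id) : HasFiniteInjectiveDimension R A := by
  obtain ⟨n, hn⟩ := h
  have e : Retract (ModuleCat.of R A) (ModuleCat.of R B) :=
    { i := ModuleCat.ofHom i
      r := ModuleCat.ofHom r
      retract := by
        rw [← ModuleCat.ofHom_comp, hr]
        rfl }
  exact ⟨n, e.hasInjectiveDimensionLT (n + 1)⟩

lemma HasFiniteInjectiveDimension.localizedModule {R : Type u} [CommRing R] [IsNoetherianRing R]
    {A : Type u} [AddCommGroup A] [Module R A] (h : HasFiniteInjectiveDimension R A)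
    (S : Submonoid R) : HasFiniteInjectiveDimension (Localization S) (LocalizedModule S A) := by
  obtain ⟨n, hn⟩ := h
  have := ModuleCat.localizedModule_hasInjectiveDimensionLE n S (ModuleCat.of R A)
  exact ⟨n, (ModuleCat.hasInjectiveDimensionLE_iff_of_linearEquiv
    (M := (ModuleCat.of R A).localizedModule S)
    (N := ModuleCat.of (Localization S) (LocalizedModule S A))
    (Shrink.linearEquiv.{u} (Localization S) (LocalizedModule S A)) n).mp this⟩

/-- A local ring over which some nonzero finitely generated projective module has finite injective
dimension has finite injective dimension over itself. -/
lemma HasFiniteInjectiveDimension.of_projective {R : Type u} [CommRing R] [IsLocalRing R]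
    {A : Type u} [AddCommGroup A] [Module R A] [Module.Finite R A] [Module.Projective R A]
    [Nontrivial A] (h : HasFiniteInjectiveDimension R A) : HasFiniteInjectiveDimension R R := by
  have : Module.Free R A := Module.free_of_flat_of_isLocalRing
  let b := Module.Free.chooseBasis R A
  obtain ⟨j⟩ := b.index_nonempty
  exact h.of_retract (LinearMap.toSpanSingleton R A (b j)) (b.coord j) (by ext; simp)

end InjectiveDimension

/-! ### From a syzygy to the Gorenstein punctured spectrum -/

section Main

variable {R : Type u} [CommRing R] [IsLocalRing R] [IsNoetherianRing R]

/-- If `T` is a faithful `(e + 1)`-syzygy of injective dimension `e + 1`, then `R` is Gorenstein on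
the punctured spectrum. -/
lemma HasFiniteInjectiveDimension.localization_of_isSyzygy {T : Type u} [AddCommGroup T]
    [Module R T] [Module.Finite R T] (hT : HasFiniteInjectiveDimension R T)
    (hann : Module.annihilator R T = ⊥) {e : ℕ} (hle : FgInjDimLE R T (e + 1))
    (hsyz : IsSyzygy R T (e + 1)) (p : Ideal R) [hp : p.IsPrime] (hpm : p ≠ maximalIdeal R) :
    HasFiniteInjectiveDimension (Localization.AtPrime p) (LocalizedModule p.primeCompl R) := by
  obtain ⟨P, f, hfin, hproj, hf, hC⟩ := hsyz.exists_embedding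
  obtain ⟨s, hs, hsp⟩ := SetLike.not_le_iff_exists.mp
    fun h ↦ hpm (le_antisymm (le_maximalIdeal hp.ne_top) h)
  -- The cokernel is an `e`-th syzygy, so its `Ext¹` shifts exactly to the top degree `1 + e`.
  obtain ⟨t, ht⟩ := hle.exists_pow_smul_eq_zero_of_isSyzygy hs _ hC one_pos (by omega)
  obtain ⟨ψ, hψ⟩ := exists_extend_smul f.exact_map_mkQ_range hf (Submodule.mkQ_surjective _) ht
    LinearMap.id
  have hu : IsUnit (algebraMap R (Localization.AtPrime p) (s ^ t)) :=
    IsLocalization.map_units (Localization.AtPrime p)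
      (⟨s ^ t, fun h ↦ hsp (hp.mem_of_pow_mem t h)⟩ : p.primeCompl)
  obtain ⟨v, hv⟩ := hu
  have hsplit : ((↑v⁻¹ : Localization.AtPrime p) • locMap p ψ) ∘ₗ locMap p f = LinearMap.id := by
    refine linearMap_localizedModule_ext p fun x ↦ ?_
    have h1 : ψ (f x) = s ^ t • x := congr($hψ x)
    rw [LinearMap.comp_apply, locMap_mkLinearMap, LinearMap.smul_apply, locMap_mkLinearMap, h1,
      map_smul, ← algebraMap_smul (Localization.AtPrime p) (s ^ t), ← hv, smul_smul,
      Units.inv_mul, one_smul, LinearMap.id_apply]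
  have : Module.Projective (Localization.AtPrime p) (LocalizedModule p.primeCompl T) :=
    .of_split _ _ hsplit
  have : Nontrivial (LocalizedModule p.primeCompl T) := by
    have hmem : (⟨p, hp⟩ : PrimeSpectrum R) ∈ Module.support R T := by
      rw [Module.support_eq_zeroLocus, hann]
      simp
    exact Module.mem_support_iff.mp hmem
  have e : LocalizedModule p.primeCompl R ≃ₗ[Localization.AtPrime p] Localization.AtPrime p :=
    LinearEquiv.extendScalarsOfIsLocalization p.primeCompl _
      (IsLocalizedModule.linearEquiv p.primeCompl (LocalizedModule.mkLinearMap p.primeCompl R)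
        (Algebra.linearMap R (Localization.AtPrime p)))
  exact ((hT.localizedModule p.primeCompl).of_projective).of_retract e.toLinearMap
    e.symm.toLinearMap (by ext; simp)

omit [IsNoetherianRing R] in
-- Of the type-one condition, only the nonvanishing of `Ext^d(k, ω)` enters the argument.
lemma HasTypeOne.not_extVanishes {T : Type u} [AddCommGroup T] [Module R T]
    (h : HasTypeOne R T) {d : ℕ} (hd : depth R T = d) :
    ¬ ExtVanishes R (ResidueField R) T d := by
  obtain ⟨n, hn, ⟨e⟩⟩ := h
  obtain rfl : n = d := by exact_mod_cast hn.symm.trans hd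
  intro hV
  have : Nontrivial (ResidueField R) := inferInstance
  exact not_subsingleton (ResidueField R) (@Equiv.subsingleton _ _ e.symm.toEquiv hV)

lemma height_le_sub_one_iff {d : ℕ} (hd : ringKrullDim R = d) (p : Ideal R) [p.IsPrime] :
    (∃ h : ℕ, p.height = h ∧ (h : ℤ) ≤ (d : ℤ) - 1) ↔ p ≠ maximalIdeal R := by
  have hm : (maximalIdeal R).height = d := by
    have := IsLocalRing.maximalIdeal_height_eq_ringKrullDim (R := R)
    rw [hd] at this
    exact_mod_cast this
  constructor
  · rintro ⟨h, hh, hle⟩ rfl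
    have : h = d := by exact_mod_cast hh.symm.trans hm
    omega
  · intro hp
    have hlt := Ideal.height_strict_mono_of_isPrime_of_isPrime
      (lt_of_le_of_ne (le_maximalIdeal (Ideal.IsPrime.ne_top ‹_›)) hp)
    rw [hm] at hlt
    obtain ⟨h, hh⟩ := ENat.ne_top_iff_exists.mp (ne_top_of_lt hlt)
    rw [← hh] at hlt
    have : h < d := by exact_mod_cast hlt
    exact ⟨h, hh.symm, by omega⟩

end Main

end CMSyzygy

theorem corollary4p2 (R : Type u) [CommRing R] [IsLocalRing R]
    (hR : CMSyzygy.IsCohenMacaulayLocalRing R)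
    (d : ℕ) (hd : ringKrullDim R = d)
    (ω : Type u) [AddCommGroup ω] [Module R ω] (hω : CMSyzygy.IsCanonicalModule R ω) :
    [CMSyzygy.SatisfiesG R R ((d : ℤ) - 1),
      ∀ (M : Type u) [AddCommGroup M] [Module R M],
        CMSyzygy.IsMaximalCohenMacaulay R M → CMSyzygy.IsSyzygy R M d,
      CMSyzygy.IsSyzygy R ω d].TFAE := by
  have := hR.isNoetherianRing
  have hdepth (M : Type u) [AddCommGroup M] [Module R M]
      (h : (CMSyzygy.depth R M : WithBot ℕ∞) = ringKrullDim R) : CMSyzygy.depth R M = d := by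
    rw [hd] at h
    exact_mod_cast h
  have hRd : CMSyzygy.DepthGE R R d := CMSyzygy.depthGE_of_le_depth (hdepth R hR.depth_eq).ge
  have hiff := CMSyzygy.height_le_sub_one_iff hd
  tfae_have 1 → 2 := by
    intro hG M _ _ hM
    have := hM.finite
    have := hM.nontrivial
    have hMd := CMSyzygy.depthGE_of_le_depth (hdepth M hM.depth_eq).ge
    have hG' (p : Ideal R) [p.IsPrime] (hp : p ≠ IsLocalRing.maximalIdeal R) :=
      hG p ((hiff p).mpr hp)
    exact CMSyzygy.LocallyExtVanishes.isSyzygy hG' hRd hMd fun p _ hp i hi ↦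
      CMSyzygy.extVanishes_localization hd hRd hMd p (hG' p hp) hi
  tfae_have 2 → 3 := fun h ↦ h ω hω.isMaximalCohenMacaulay
  tfae_have 3 → 1 := by
    intro hsyz p _ hp
    have hpm := (hiff p).mp hp
    -- For `d = 0` the height bound is `-1`, so there is no such prime.
    obtain _ | e := d
    · obtain ⟨h, -, hle⟩ := hp
      omega
    have := hω.isMaximalCohenMacaulay.finite
    have := hω.isMaximalCohenMacaulay.nontrivial
    have hdω := hdepth ω hω.isMaximalCohenMacaulay.depth_eq
    obtain ⟨n, hn⟩ := hω.hasFiniteInjectiveDimension.exists_fgInjDimLE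
    have hle := hRd.fgInjDimLE hd hn
    exact hω.hasFiniteInjectiveDimension.localization_of_isSyzygy
      (hle.annihilator_eq_bot (CMSyzygy.depthGE_of_le_depth hdω.ge)
        (hω.hasTypeOne.not_extVanishes hdω)) hle hsyz p hpm
  tfae_finish
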